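/- Let $g,b:\mathbb R\to\mathbb R$ be Lebesgue measurable, $1$-periodic, and bounded above and below almost everywhere by positive constants; put $\overline g=\int_0^1 g$ and $\overline b=\int_0^1 b$. Let $R=R(y,T)$, defined for $y\in\mathbb R$ and $T>0$, be such that: for almost every $y$, $T\mapsto R(y,T)$ is continuous and nondecreasing on $(0,\infty)$; for every $T>0$, $y\mapsto R(y,T)$ is Lebesgue measurable and $1$-periodic; there is a constant $R_M$ such that, for almost every $y$, $0<R(y,T)\le R_M$ for all $T>0$; and $\operatorname{ess\,inf}_{y}R(y,T)>0$ for every $T>0$. Put $\mathscr R(z)=R\left(z,\overline g/\overline b\right)$. Let $W^{2,\infty}_{\mathrm{per}}$ be the space of $1$-periodic functions in $W^{2,\infty}(\mathbb R)$, with the norm $\max\{\|w\|_\infty,\|w_z\|_\infty,\|w_{zz}\|_\infty\}$. Then for every $\lambda\in(0,\infty)$ there is exactly one pair $(c,w)=(c^0(\lambda),w(\cdot,\lambda))\in\mathbb R\times W^{2,\infty}_{\mathrm{per}}$ such that $$-c+\mathscr R(z)\sqrt{1+w_z^2}=\lambda\,\frac{w_{zz}}{1+w_z^2}\quad\text{for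 almost every }z\in\mathbb R,\qquad \int_0^1 w(t)\,dt=0 .$$ The map $\lambda\in(0,\infty)\mapsto w(\cdot,\lambda)\in W^{2,\infty}_{\mathrm{per}}$ is $C^\infty$; it is injective whenever $\mathscr R$ is not almost everywhere equal to a constant; and $w(\cdot,\lambda)\to0$ in $W^{2,\infty}(\mathbb R)$ as $\lambda\to+\infty$. -/

import Mathlib

open MeasureTheory Set Filter Topology
open scoped ContDiff

/-- The Banach space `L^∞(ℝ)` with Lebesgue measure. -/
abbrev LInf : Type := Lp ℝ (⊤ : ENNReal) (volume : Measure ℝ)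

/-- `v` is the weak (distributional) derivative of `u` on `ℝ`. -/
def IsWeakDeriv (u v : LInf) : Prop :=
  ∀ φ : ℝ → ℝ, ContDiff ℝ ∞ φ → HasCompactSupport φ →
    ∫ z, u z * deriv φ z = - ∫ z, v z * φ z

theorem LInf.integrable_mul (u : LInf) {ψ : ℝ → ℝ} (hψ : Continuous ψ)
    (hc : HasCompactSupport ψ) : Integrable (fun z => u z * ψ z) volume :=
  (hψ.integrable_of_hasCompactSupport hc).mul_of_top_right (Lp.memLp u)

theorem LInf.integral_add_mul (u v : LInf) {ψ : ℝ → ℝ} (hψ : Continuous ψ)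
    (hc : HasCompactSupport ψ) :
    ∫ z, (u + v : LInf) z * ψ z = (∫ z, u z * ψ z) + ∫ z, v z * ψ z := by
  rw [← integral_add (u.integrable_mul hψ hc) (v.integrable_mul hψ hc)]
  refine integral_congr_ae ?_
  filter_upwards [Lp.coeFn_add u v] with z hz
  rw [hz, Pi.add_apply, add_mul]

theorem LInf.integral_smul_mul (r : ℝ) (u : LInf) (ψ : ℝ → ℝ) :
    ∫ z, (r • u : LInf) z * ψ z = r * ∫ z, u z * ψ z := by
  rw [← integral_const_mul]
  refine integral_congr_ae ?_
  filter_upwards [Lp.coeFn_smul r u] with z hz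
  rw [hz, Pi.smul_apply, smul_eq_mul, mul_assoc]

theorem IsWeakDeriv.zero : IsWeakDeriv 0 0 := by
  intro φ _ _
  have h : ∀ ψ : ℝ → ℝ, ∫ z, (0 : LInf) z * ψ z = 0 := fun ψ => by
    simpa only [zero_smul, zero_mul] using LInf.integral_smul_mul 0 0 ψ
  rw [h, h, neg_zero]

theorem IsWeakDeriv.add {u v u' v' : LInf} (h : IsWeakDeriv u v) (h' : IsWeakDeriv u' v') :
    IsWeakDeriv (u + u') (v + v') := by
  intro φ hφ hc
  rw [LInf.integral_add_mul u u' (hφ.continuous_deriv (by simp)) hc.deriv,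
    LInf.integral_add_mul v v' hφ.continuous hc, h φ hφ hc, h' φ hφ hc, neg_add]

theorem IsWeakDeriv.smul (r : ℝ) {u v : LInf} (h : IsWeakDeriv u v) :
    IsWeakDeriv (r • u) (r • v) := by
  intro φ hφ hc
  rw [LInf.integral_smul_mul, LInf.integral_smul_mul, h φ hφ hc, mul_neg]

/-- The space `W^{2,∞}_per(ℝ)` of `1`-periodic functions in `W^{2,∞}(ℝ)`. An element is a function
`w ∈ L^∞(ℝ)` listed together with its first and second weak derivatives, which are required to be
in `L^∞(ℝ)` and are determined by `w`. The norm inherited from the product is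
`max (‖w‖_∞) (‖w_z‖_∞) (‖w_zz‖_∞)`. -/
def W2InfPer : Submodule ℝ (LInf × LInf × LInf) where
  carrier := {p | IsWeakDeriv p.1 p.2.1 ∧ IsWeakDeriv p.2.1 p.2.2 ∧
    ∀ᵐ z : ℝ, p.1 (z + 1) = p.1 z}
  zero_mem' := by
    refine ⟨IsWeakDeriv.zero, IsWeakDeriv.zero, ?_⟩
    have h := Lp.coeFn_zero ℝ (⊤ : ENNReal) (volume : Measure ℝ)
    filter_upwards [h, (measurePreserving_add_right volume (1 : ℝ)).quasiMeasurePreserving.ae h]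
      with z h1 h2
    change (0 : LInf) (z + 1) = (0 : LInf) z
    rw [h1, h2]; rfl
  add_mem' := by
    rintro p q ⟨hp1, hp2, hp⟩ ⟨hq1, hq2, hq⟩
    refine ⟨hp1.add hq1, hp2.add hq2, ?_⟩
    have h := Lp.coeFn_add p.1 q.1
    filter_upwards [h, (measurePreserving_add_right volume (1 : ℝ)).quasiMeasurePreserving.ae h,
      hp, hq] with z h1 h2 h3 h4
    change (p.1 + q.1 : LInf) (z + 1) = (p.1 + q.1 : LInf) z
    rw [h1, h2, Pi.add_apply, Pi.add_apply, h3, h4]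
  smul_mem' := by
    rintro r p ⟨hp1, hp2, hp⟩
    refine ⟨hp1.smul r, hp2.smul r, ?_⟩
    have h := Lp.coeFn_smul r p.1
    filter_upwards [h, (measurePreserving_add_right volume (1 : ℝ)).quasiMeasurePreserving.ae h,
      hp] with z h1 h2 h3
    change (r • p.1 : LInf) (z + 1) = (r • p.1 : LInf) z
    rw [h1, h2, Pi.smul_apply, Pi.smul_apply, h3]

/-- The function underlying an element of `W^{2,∞}_per`. -/
def W2InfPer.toLInf (w : W2InfPer) : LInf := w.1.1

/-- The weak derivative `w_z`. -/
def W2InfPer.dz (w : W2InfPer) : LInf := w.1.2.1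

/-- The second weak derivative `w_zz`. -/
def W2InfPer.dzz (w : W2InfPer) : LInf := w.1.2.2

/-- Standing assumptions on a material parameter: Lebesgue measurable, `1`-periodic, bounded above,
and bounded below by a positive constant. -/
structure IsMaterialParameter (f : ℝ → ℝ) : Prop where
  aemeasurable : AEMeasurable f volume
  periodic : Function.Periodic f 1
  bounds : ∃ fm fM : ℝ, 0 < fm ∧ ∀ᵐ y : ℝ, fm ≤ f y ∧ f y ≤ fM

/-- Standing assumptions on a combustion rate `R = R(y,T)`; only the values at `T > 0` matter. -/
structure IsCombustionRate (R : ℝ → ℝ → ℝ) : Prop where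
  continuousOn : ∀ᵐ y : ℝ, ContinuousOn (R y) (Ioi 0)
  monotoneOn : ∀ᵐ y : ℝ, MonotoneOn (R y) (Ioi 0)
  aemeasurable : ∀ T : ℝ, 0 < T → AEMeasurable (fun y => R y T) volume
  periodic : ∀ T : ℝ, 0 < T → Function.Periodic (fun y => R y T) 1
  bounds : ∃ RM : ℝ, ∀ᵐ y : ℝ, ∀ T : ℝ, 0 < T → 0 < R y T ∧ R y T ≤ RM
  essinf_pos : ∀ T : ℝ, 0 < T → ∃ m : ℝ, 0 < m ∧ ∀ᵐ y : ℝ, m ≤ R y T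

/-- The mean value over one period of a `1`-periodic function. -/
noncomputable def periodMean (f : ℝ → ℝ) : ℝ := ∫ z in (0 : ℝ)..1, f z

/-- The combustion rate `z ↦ R(z, ḡ / b̄)` at the homogenized temperature of the front. -/
noncomputable def cellRate (R : ℝ → ℝ → ℝ) (g b : ℝ → ℝ) (z : ℝ) : ℝ :=
  R z (periodMean g / periodMean b)

/-- `(c, w)` solves the cell problem with rate `ρ` and curvature regime `lam`:
`-c + ρ √(1 + w_z²) = lam w_zz / (1 + w_z²)` almost everywhere, `w` being `1`-periodic with zero
mean. -/
def IsCorrector (ρ : ℝ → ℝ) (lam c : ℝ) (w : W2InfPer) : Prop :=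
  (∀ᵐ z : ℝ, -c + ρ z * Real.sqrt (1 + (W2InfPer.dz w z) ^ 2) =
    lam * (W2InfPer.dzz w z / (1 + (W2InfPer.dz w z) ^ 2))) ∧
    periodMean (W2InfPer.toLInf w) = 0

/-! Write `ρ` for the cell rate, `p = w_z`, and `μ = lam⁻¹`. With the sine and cosine of the slope
angle, the equation becomes `(sin p)' = μ (ρ - c cos p)`. It is integrated once, so that the merely
measurable `ρ` enters only through its continuous primitive `S`. The unknowns are `p`, `c` and the
initial sine `e`; the equations are the integrated one, the periodicity condition `S 1 = c ∫ cos p`,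
and `∫ p = 0`. This is `cellMap S (μ, p, c, e) = 0`, a smooth equation on `C([0,1]) × ℝ²` that makes
sense for every real `μ`.

One linear fact, `eq_zero_of_linear_periodic`, serves twice. A periodic solution of `d' = a d + γ β`
with `β > 0` that vanishes somewhere is zero, and `γ = 0`. Applied to the difference of two sines it
gives uniqueness; applied to the linearization it gives injectivity, which finite-dimensional linear
algebra upgrades to invertibility. The common zero comes from a mean-zero condition.

Existence is by continuation in `μ` from the flat solution at `μ = 0`. The solvable set is open by
the implicit function theorem, and closed because the bounds `m ≤ c ≤ M`, `|p| ≤ M / m` and a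
Lipschitz bound give compactness (Arzelà–Ascoli). By uniqueness the local smooth branches are the
global solution, which is therefore smooth in `μ`.

Finally `w_zz = μ (1 + p²) (ρ √(1 + p²) - c)` has the form `ρ a + b` with `a, b` continuous and
smooth in `μ`. A fixed bounded operator takes `(a, b)` to `w`, so `w` is smooth into `W^{2,∞}`, and
it tends to `0` because the coefficients vanish at `μ = 0`. If two regimes share `w`, subtracting
their equations makes `w_zz / (1 + w_z²)` constant; periodicity forces `w_z = 0`, hence `ρ` is
constant. -/

/-! ### Smoothness of superposition operators -/

/-- The superposition (Nemytskii) operator `u ↦ f ∘ u` on continuous functions. -/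
def superpose {K : Type*} [TopologicalSpace K] (f : ℝ → ℝ) (hf : Continuous f) (u : C(K, ℝ)) :
    C(K, ℝ) :=
  ⟨fun x => f (u x), hf.comp u.continuous⟩

@[simp] theorem superpose_apply {K : Type*} [TopologicalSpace K] (f : ℝ → ℝ) (hf : Continuous f)
    (u : C(K, ℝ)) (x : K) : superpose f hf u x = f (u x) := rfl

/-- The remainder is uniform in `x` because `deriv f` is uniformly continuous on a compact interval
containing the ranges of `u` and of its small perturbations. -/
theorem hasFDerivAt_superpose {K : Type*} [TopologicalSpace K] [CompactSpace K] {f : ℝ → ℝ}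
    (hf : ContDiff ℝ 1 f) (u : C(K, ℝ)) :
    HasFDerivAt (superpose (K := K) f hf.continuous)
      (ContinuousLinearMap.mul ℝ C(K, ℝ)
        (superpose (deriv f) (hf.continuous_deriv le_rfl) u)) u := by
  have hd := hf.continuous_deriv le_rfl
  rw [hasFDerivAt_iff_isLittleO_nhds_zero, Asymptotics.isLittleO_iff]
  intro ε hε
  have huc : UniformContinuousOn (deriv f) (Icc (-(‖u‖ + 1)) (‖u‖ + 1)) :=
    isCompact_Icc.uniformContinuousOn_of_continuous hd.continuousOn
  obtain ⟨δ, hδ, hδ'⟩ := Metric.uniformContinuousOn_iff.1 huc ε hε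
  filter_upwards [Metric.ball_mem_nhds (0 : C(K, ℝ)) (lt_min hδ one_pos)] with h hh
  rw [mem_ball_zero_iff, lt_min_iff] at hh
  rw [ContinuousMap.norm_le _ (by positivity)]
  intro x
  have hux : |u x| ≤ ‖u‖ := u.norm_coe_le_norm x
  have hhx : |h x| ≤ ‖h‖ := h.norm_coe_le_norm x
  have hmem : ∀ y ∈ segment ℝ (u x) (u x + h x), |y - u x| ≤ |h x| := by
    intro y hy
    rw [segment_eq_uIcc] at hy
    simpa using abs_sub_left_of_mem_uIcc hy
  have key := (convex_segment (u x) (u x + h x)).norm_image_sub_le_of_norm_hasDerivWithin_le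
    (f := fun y => f y - deriv f (u x) * y) (f' := fun y => deriv f y - deriv f (u x)) (C := ε)
    (fun y _ => ((((hf.differentiable one_ne_zero) y).hasDerivAt.sub
      ((hasDerivAt_id y).const_mul (deriv f (u x)))).congr_deriv (by simp)).hasDerivWithinAt)
    (fun y hy => ?_) (left_mem_segment ℝ _ _) (right_mem_segment ℝ _ _)
  · simp only [ContinuousMap.sub_apply, superpose_apply, ContinuousMap.add_apply,
      ContinuousLinearMap.mul_apply', ContinuousMap.mul_apply]
    have e : f (u x + h x) - f (u x) - deriv f (u x) * h x
      = f (u x + h x) - deriv f (u x) * (u x + h x) - (f (u x) - deriv f (u x) * u x) := by ring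
    rw [e]
    refine key.trans ?_
    simp only [add_sub_cancel_left, Real.norm_eq_abs]
    gcongr
  · have h1 := hmem y hy
    refine (hδ' y ?_ (u x) ?_ ?_).le
    · rw [mem_Icc, ← abs_le]
      calc |y| = |u x + (y - u x)| := by ring_nf
        _ ≤ |u x| + |y - u x| := abs_add_le _ _
        _ ≤ _ := by linarith
    · rw [mem_Icc, ← abs_le]; linarith
    · rw [Real.dist_eq]; linarith

/-- The derivative is multiplication by a superposition with `deriv f`, so the order of smoothness
can be raised by induction over all `f` at once. -/
theorem contDiff_superpose {K : Type*} [TopologicalSpace K] [CompactSpace K] {f : ℝ → ℝ}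
    (hf : ContDiff ℝ ∞ f) : ContDiff ℝ ∞ (superpose (K := K) f hf.continuous) := by
  rw [contDiff_infty]
  intro n
  induction n generalizing f with
  | zero =>
    have h1 : ContDiff ℝ 1 f := hf.of_le (by exact_mod_cast le_top)
    exact contDiff_zero.2 (continuous_iff_continuousAt.2
      fun u => (hasFDerivAt_superpose h1 u).continuousAt)
  | succ n ih =>
    have h1 : ContDiff ℝ 1 f := hf.of_le (by exact_mod_cast le_top)
    have h2 : ContDiff ℝ ∞ (deriv f) := (contDiff_infty_iff_deriv.1 hf).2
    rw [Nat.cast_add, Nat.cast_one, contDiff_succ_iff_hasFDerivAt]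
    refine ⟨fun u => ContinuousLinearMap.mul ℝ C(K, ℝ)
      (superpose (deriv f) h2.continuous u), ?_, fun u => hasFDerivAt_superpose h1 u⟩
    have := ih h2
    fun_prop

/-! ### Volterra integration and linear equations on the unit interval -/

/-- The extension of a continuous function on `[0, 1]` to `ℝ` by its end values. -/
noncomputable def unitExtend (u : C(unitInterval, ℝ)) : ℝ → ℝ := IccExtend zero_le_one u

theorem continuous_unitExtend (u : C(unitInterval, ℝ)) : Continuous (unitExtend u) :=
  u.continuous.Icc_extend'

theorem unitExtend_of_mem (u : C(unitInterval, ℝ)) {x : ℝ} (hx : x ∈ Icc (0 : ℝ) 1) :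
    unitExtend u x = u ⟨x, hx⟩ := IccExtend_of_mem _ _ hx

@[simp] theorem unitExtend_coe (u : C(unitInterval, ℝ)) (x : unitInterval) :
    unitExtend u x = u x := unitExtend_of_mem u x.2

theorem norm_unitExtend_le (u : C(unitInterval, ℝ)) (x : ℝ) : ‖unitExtend u x‖ ≤ ‖u‖ :=
  u.norm_coe_le_norm _

/-- Integration from `0`, as a bounded operator on `C([0, 1])`. -/
noncomputable def volterra : C(unitInterval, ℝ) →L[ℝ] C(unitInterval, ℝ) :=
  LinearMap.mkContinuous
    { toFun := fun u => ⟨fun z => ∫ t in (0 : ℝ)..z, unitExtend u t,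
        (intervalIntegral.continuous_primitive
          (fun _ _ => (continuous_unitExtend u).intervalIntegrable _ _) 0).comp
          continuous_subtype_val⟩
      map_add' := fun u v => by
        ext z
        exact intervalIntegral.integral_add ((continuous_unitExtend u).intervalIntegrable _ _)
          ((continuous_unitExtend v).intervalIntegrable _ _)
      map_smul' := fun r u => by
        ext z
        exact intervalIntegral.integral_const_mul r _ } 1 (fun u => by
    rw [one_mul, ContinuousMap.norm_le _ (norm_nonneg u)]
    intro z
    refine (intervalIntegral.norm_integral_le_of_norm_le_const
      (fun t _ => norm_unitExtend_le u t)).trans ?_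
    rw [sub_zero, abs_of_nonneg z.2.1]
    exact mul_le_of_le_one_right (norm_nonneg u) z.2.2)

theorem volterra_apply (u : C(unitInterval, ℝ)) (z : unitInterval) :
    volterra u z = ∫ t in (0 : ℝ)..z, unitExtend u t := rfl

@[simp] theorem volterra_zero_apply (u : C(unitInterval, ℝ)) : volterra u 0 = 0 := by
  simp [volterra_apply]

theorem hasDerivAt_integral_unitExtend (u : C(unitInterval, ℝ)) (x : ℝ) :
    HasDerivAt (fun x => ∫ t in (0 : ℝ)..x, unitExtend u t) (unitExtend u x) x :=
  intervalIntegral.integral_hasDerivAt_right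
    ((continuous_unitExtend u).intervalIntegrable _ _)
    ((continuous_unitExtend u).stronglyMeasurableAtFilter _ _) (continuous_unitExtend u).continuousAt

theorem volterra_eq_of_hasDerivAt {u : C(unitInterval, ℝ)} {F F' : ℝ → ℝ}
    (hF : ∀ x, HasDerivAt F (F' x) x) (hu : ∀ x : unitInterval, F' x = u x) (z : unitInterval) :
    volterra u z = F z - F 0 := by
  have hcont : EqOn (unitExtend u) F' (Icc 0 1) := fun x hx => by
    rw [unitExtend_of_mem u hx, ← hu]
  have hsub : uIcc 0 (z : ℝ) ⊆ Icc 0 1 := by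
    rw [uIcc_of_le z.2.1]; exact Icc_subset_Icc_right z.2.2
  rw [volterra_apply]
  refine intervalIntegral.integral_eq_sub_of_hasDerivAt (fun x hx => ?_)
    ((continuous_unitExtend u).intervalIntegrable _ _)
  rw [hcont (hsub hx)]
  exact hF x

/-- Integration by parts in operator form; it lets differential equations be handled algebraically
in their integrated form. -/
theorem volterra_mul_volterra (u v : C(unitInterval, ℝ)) :
    volterra u * volterra v = volterra (u * volterra v + volterra u * v) := by
  ext z
  rw [volterra_eq_of_hasDerivAt (fun x => (hasDerivAt_integral_unitExtend u x).mul
    (hasDerivAt_integral_unitExtend v x)) (fun x => ?_) z]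
  · simp [volterra_apply]
  · simp [volterra_apply]

/-- The integrating factor `exp (-∫₀ᶻ a)`. -/
noncomputable def integratingFactor (a : C(unitInterval, ℝ)) : C(unitInterval, ℝ) :=
  superpose (fun x => Real.exp (-x)) (by fun_prop) (volterra a)

theorem integratingFactor_pos (a : C(unitInterval, ℝ)) (z : unitInterval) :
    0 < integratingFactor a z := Real.exp_pos _

theorem integratingFactor_eq (a : C(unitInterval, ℝ)) :
    integratingFactor a = 1 - volterra (a * integratingFactor a) := by
  ext z
  have h := volterra_eq_of_hasDerivAt (u := a * integratingFactor a)
    (fun x => (((hasDerivAt_integral_unitExtend a x).neg.exp).neg)) (fun x => ?_) z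
  · rw [ContinuousMap.sub_apply, h]
    simp [integratingFactor, volterra_apply]
  · simp [integratingFactor, volterra_apply, mul_comm]

/-- Integrated form of `(E d)' = E f` for `d' = a d + f`. -/
theorem integratingFactor_mul_of_eq {a f d : C(unitInterval, ℝ)} {e : ℝ}
    (hd : d = e • 1 + volterra (a * d + f)) :
    integratingFactor a * d = e • 1 + volterra (integratingFactor a * f) := by
  set E := integratingFactor a with hE
  have hE' : E = 1 - volterra (a * E) := integratingFactor_eq a
  have h1 := volterra_mul_volterra (a * E) (a * d + f)
  have h2 : volterra (a * d + f) = d - e • 1 := by rw [eq_sub_iff_add_eq', ← hd]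
  have h3 : volterra (a * E) = 1 - E := by rw [eq_sub_iff_add_eq, ← eq_sub_iff_add_eq', ← hE']
  rw [h2, h3] at h1
  have h4 : a * E * (d - e • 1) + (1 - E) * (a * d + f)
      = (a * d + f) - E * f - e • (a * E) := by
    rw [mul_sub, mul_smul_comm, mul_one]; ring
  rw [h4, map_sub, map_sub, map_smul, h2, h3] at h1
  have h5 : (1 - E) * (d - e • 1) = d - e • 1 - E * d + e • E := by
    rw [mul_sub, mul_smul_comm, mul_one, smul_sub]; ring
  rw [h5] at h1
  rw [smul_sub] at h1
  linear_combination (exp := 1) -h1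

/-- A periodic solution of `d' = a d + γ β`, `β > 0`, that vanishes somewhere is zero. -/
theorem eq_zero_of_linear_periodic {a β d : C(unitInterval, ℝ)} {e γ : ℝ}
    (hβ : ∀ z, 0 < β z) (hd : d = e • 1 + volterra (a * d + γ • β)) (hper : d 1 = d 0)
    {z₀ : unitInterval} (hz₀ : d z₀ = 0) : γ = 0 ∧ d = 0 := by
  have h := integratingFactor_mul_of_eq hd
  set E := integratingFactor a with hE
  have hJ : ∀ z, E z * d z = e + γ * volterra (E * β) z := fun z => by
    have := DFunLike.congr_fun h z
    simpa [mul_smul_comm] using this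
  have hEβ : ∀ x, 0 ≤ unitExtend (E * β) x := fun x =>
    (mul_pos (integratingFactor_pos a _) (hβ _)).le
  have hint : ∀ x y : ℝ, IntervalIntegrable (unitExtend (E * β)) volume x y :=
    fun x y => (continuous_unitExtend _).intervalIntegrable _ _
  have hJ1 : 0 < volterra (E * β) 1 :=
    intervalIntegral.intervalIntegral_pos_of_pos (hint _ _)
      (fun x => mul_pos (integratingFactor_pos a _) (hβ _)) zero_lt_one
  have hJ0 : 0 ≤ volterra (E * β) z₀ :=
    intervalIntegral.integral_nonneg z₀.2.1 fun x _ => hEβ x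
  have hJ01 : volterra (E * β) z₀ ≤ volterra (E * β) 1 := by
    rw [volterra_apply, volterra_apply]
    exact intervalIntegral.integral_mono_interval le_rfl z₀.2.1 z₀.2.2
      (Eventually.of_forall hEβ) (hint _ _)
  have e0 : E 0 = 1 := by simp [hE, integratingFactor]
  have e1 := integratingFactor_pos a 1
  rw [← hE] at e1
  have i0 := hJ 0
  have i1 := hJ 1
  have iz := hJ z₀
  rw [hz₀, mul_zero] at iz
  rw [e0, one_mul, volterra_zero_apply, mul_zero, add_zero] at i0
  rw [hper, i0] at i1
  -- With `J = volterra (E * β)`, eliminating `e` leaves `γ (J 1 - J z₀ + E 1 * J z₀) = 0`. Both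
  -- parts of the bracket are nonnegative, and they cannot both vanish because `J 1 > 0`.
  have hγ : γ = 0 := by
    by_contra hγ
    have k1 : e = -(γ * volterra (E * β) z₀) := by linarith
    have k2 : γ * (volterra (E * β) 1 - volterra (E * β) z₀ + E 1 * volterra (E * β) z₀) = 0 := by
      rw [k1] at i1; linarith
    have k3 := (mul_eq_zero.1 k2).resolve_left hγ
    have k4 : E 1 * volterra (E * β) z₀ = 0 :=
      le_antisymm (by linarith) (mul_nonneg e1.le hJ0)
    have k5 := (mul_eq_zero.1 k4).resolve_left e1.ne'
    rw [k5] at k3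
    linarith
  refine ⟨hγ, ?_⟩
  ext z
  have := hJ z
  rw [hγ] at this iz
  rw [zero_mul, add_zero] at this iz
  rw [← iz] at this
  exact (mul_eq_zero.1 this).resolve_left (integratingFactor_pos a z).ne'

theorem bijective_sub_volterra (a : C(unitInterval, ℝ)) :
    Function.Bijective fun y : C(unitInterval, ℝ) => y - volterra (a * y) := by
  set E := integratingFactor a with hE
  constructor
  · intro y₁ y₂ h
    have h' : y₁ - y₂ = (0 : ℝ) • 1 + volterra (a * (y₁ - y₂) + (0 : ℝ) • 1) := by
      simp only at h
      rw [zero_smul, zero_add, add_zero, mul_sub, map_sub]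
      linear_combination (exp := 1) h
    refine sub_eq_zero.1 (eq_zero_of_linear_periodic (z₀ := 0) (γ := 0) (β := 1)
      (fun _ => one_pos) h' ?_ ?_).2
    · have := integratingFactor_mul_of_eq h'
      have h1 := DFunLike.congr_fun this 1
      have h0 := DFunLike.congr_fun this 0
      simp at h1 h0
      rw [ContinuousMap.sub_apply, ContinuousMap.sub_apply,
        h1.resolve_left (integratingFactor_pos a 1).ne',
        h0.resolve_left (integratingFactor_pos a 0).ne']
    · rw [h']; simp
  · intro h
    obtain ⟨G, hG⟩ : ∃ G : C(unitInterval, ℝ), G * E = 1 := by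
      refine ⟨superpose Real.exp (by fun_prop) (volterra a), ?_⟩
      ext z
      simp [hE, integratingFactor, ← Real.exp_add]
    have hE' : E = 1 - volterra (a * E) := integratingFactor_eq a
    have hG' : G = 1 + volterra (a * G) := by
      have hGa : G = integratingFactor (-a) := by
        ext z
        have := DFunLike.congr_fun hG z
        simp only [ContinuousMap.mul_apply, ContinuousMap.one_apply, hE, integratingFactor,
          superpose_apply] at this
        rw [Real.exp_neg, mul_inv_eq_one₀ (Real.exp_pos _).ne'] at this
        simp [integratingFactor, this]
      have := integratingFactor_eq (-a)
      rw [← hGa] at this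
      rw [neg_mul, map_neg, sub_neg_eq_add] at this
      exact this
    -- Variation of constants: `y - h` solves `z' = a z + a h` with `z 0 = 0`, and `G = E⁻¹`.
    refine ⟨h + G * volterra (E * (a * h)), ?_⟩
    have h1 := volterra_mul_volterra (a * G) (E * (a * h))
    have h2 : volterra (a * G) = G - 1 := by rw [eq_sub_iff_add_eq', ← hG']
    rw [h2] at h1
    have h3 : a * G * volterra (E * (a * h)) + (G - 1) * (E * (a * h))
      = a * (h + G * volterra (E * (a * h))) - E * (a * h) := by
      linear_combination (exp := 1) (a * h) * hG
    rw [h3, map_sub] at h1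
    simp only
    linear_combination (exp := 1) h1

/-- A linear map on `X × F`, `F` finite-dimensional, whose `X`-block is bijective, is surjective
if it is injective. -/
theorem surjective_of_injective_of_block {X F : Type*} [AddCommGroup X] [Module ℝ X]
    [AddCommGroup F] [Module ℝ F] [FiniteDimensional ℝ F] (A : X × F →ₗ[ℝ] X × F)
    (hB : Function.Bijective fun x : X => (A (x, 0)).1) (hA : Function.Injective A) :
    Function.Surjective A := by
  let B : X ≃ₗ[ℝ] X :=
    LinearEquiv.ofBijective (LinearMap.fst ℝ X F ∘ₗ A ∘ₗ LinearMap.inl ℝ X F) hB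
  have hBx : ∀ x, B x = (A (x, 0)).1 := fun x => rfl
  -- `s t` is chosen to cancel the `X`-component of `A (0, t)`. What remains is the Schur complement
  -- `G` on `F`, for which injectivity and surjectivity agree.
  let s : F →ₗ[ℝ] X :=
    - (B.symm.toLinearMap ∘ₗ LinearMap.fst ℝ X F ∘ₗ A ∘ₗ LinearMap.inr ℝ X F)
  have hsplit : ∀ x t, A (x, t) = A (x, 0) + A (0, t) := fun x t => by
    rw [← map_add, Prod.mk_add_mk, add_zero, zero_add]
  have hs : ∀ t, (A (s t, t)).1 = 0 := fun t => by
    rw [hsplit, Prod.fst_add, ← hBx]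
    simp [s]
  let G : F →ₗ[ℝ] F := LinearMap.snd ℝ X F ∘ₗ A ∘ₗ (s.prod LinearMap.id)
  have hG : ∀ t, G t = (A (s t, t)).2 := fun t => rfl
  have hGinj : Function.Injective G := by
    rw [← LinearMap.ker_eq_bot, LinearMap.ker_eq_bot']
    intro t ht
    have h0 : A (s t, t) = A 0 := by
      rw [map_zero]; exact Prod.ext (hs t) ht
    exact congrArg Prod.snd (hA h0)
  have hGsurj := LinearMap.injective_iff_surjective.1 hGinj
  rintro ⟨y, k⟩
  obtain ⟨x, hx⟩ := B.surjective y
  obtain ⟨t, ht⟩ := hGsurj (k - (A (x, 0)).2)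
  refine ⟨(x + s t, t), ?_⟩
  have : A (x + s t, t) = A (x, 0) + A (s t, t) := by
    rw [← map_add, Prod.mk_add_mk, zero_add]
  rw [this]
  refine Prod.ext ?_ ?_
  · rw [Prod.fst_add, hs, add_zero, ← hBx, hx]
  · rw [Prod.snd_add, ← hG, ht, add_sub_cancel]

/-! ### Sine and cosine of the slope angle -/

/-- The cosine of the angle of a line of slope `p`. -/
noncomputable def slopeCos (p : ℝ) : ℝ := (Real.sqrt (1 + p ^ 2))⁻¹

/-- The sine of the angle of a line of slope `p`. -/
noncomputable def slopeSin (p : ℝ) : ℝ := p * slopeCos p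

theorem slopeCos_pos (p : ℝ) : 0 < slopeCos p := by unfold slopeCos; positivity

theorem slopeCos_sq (p : ℝ) : slopeCos p ^ 2 = (1 + p ^ 2)⁻¹ := by
  rw [slopeCos, inv_pow, Real.sq_sqrt (by positivity)]

theorem one_add_sq_mul_slopeCos_sq (p : ℝ) : (1 + p ^ 2) * slopeCos p ^ 2 = 1 := by
  rw [slopeCos_sq]; field_simp

theorem slopeCos_le_one (p : ℝ) : slopeCos p ≤ 1 :=
  inv_le_one_of_one_le₀ (Real.one_le_sqrt.2 (by nlinarith [sq_nonneg p]))

theorem slopeSin_sq_add_slopeCos_sq (p : ℝ) : slopeSin p ^ 2 + slopeCos p ^ 2 = 1 := by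
  have := one_add_sq_mul_slopeCos_sq p
  rw [slopeSin]; linarith

theorem contDiff_slopeCos : ContDiff ℝ ∞ slopeCos := by
  unfold slopeCos
  exact ((contDiff_const.add (contDiff_id.pow 2)).sqrt fun p => by positivity).inv
    fun p => by positivity

theorem contDiff_slopeSin : ContDiff ℝ ∞ slopeSin := contDiff_id.mul contDiff_slopeCos

theorem hasDerivAt_slopeCos (p : ℝ) : HasDerivAt slopeCos (-(p * slopeCos p ^ 3)) p := by
  have h1 : HasDerivAt (fun p : ℝ => 1 + p ^ 2) (2 * p) p := by
    simpa using ((hasDerivAt_id p).pow 2).const_add 1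
  have h2 := (h1.sqrt (by positivity)).inv (by positivity)
  refine h2.congr_deriv ?_
  have : 0 < Real.sqrt (1 + p ^ 2) := by positivity
  rw [slopeCos]
  field_simp

theorem hasDerivAt_slopeSin (p : ℝ) : HasDerivAt slopeSin (slopeCos p ^ 3) p := by
  refine ((hasDerivAt_id p).mul (hasDerivAt_slopeCos p)).congr_deriv ?_
  have := one_add_sq_mul_slopeCos_sq p
  simp only [id, one_mul]
  linear_combination (-slopeCos p) * this

theorem slopeSin_strictMono : StrictMono slopeSin :=
  strictMono_of_deriv_pos fun p => by
    rw [(hasDerivAt_slopeSin p).deriv]; exact pow_pos (slopeCos_pos p) 3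

theorem slopeSin_neg (p : ℝ) : slopeSin (-p) = -slopeSin p := by
  simp [slopeSin, slopeCos]

theorem slopeCos_neg (p : ℝ) : slopeCos (-p) = slopeCos p := by simp [slopeCos]

@[simp] theorem slopeSin_zero : slopeSin 0 = 0 := by simp [slopeSin]

@[simp] theorem slopeCos_zero : slopeCos 0 = 1 := by simp [slopeCos]

theorem abs_slopeSin_le_one (p : ℝ) : |slopeSin p| ≤ 1 := by
  have := slopeSin_sq_add_slopeCos_sq p
  rw [← sq_le_one_iff_abs_le_one]
  nlinarith [sq_nonneg (slopeCos p)]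

/-- `slopeSin` acting on continuous functions. -/
noncomputable def sinMap : C(unitInterval, ℝ) → C(unitInterval, ℝ) :=
  superpose slopeSin contDiff_slopeSin.continuous

/-- `slopeCos` acting on continuous functions. -/
noncomputable def cosMap : C(unitInterval, ℝ) → C(unitInterval, ℝ) :=
  superpose slopeCos contDiff_slopeCos.continuous

@[simp] theorem sinMap_apply (p : C(unitInterval, ℝ)) (z : unitInterval) :
    sinMap p z = slopeSin (p z) := rfl

@[simp] theorem cosMap_apply (p : C(unitInterval, ℝ)) (z : unitInterval) :
    cosMap p z = slopeCos (p z) := rfl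

theorem contDiff_sinMap : ContDiff ℝ ∞ sinMap := contDiff_superpose contDiff_slopeSin

theorem contDiff_cosMap : ContDiff ℝ ∞ cosMap := contDiff_superpose contDiff_slopeCos

theorem hasFDerivAt_sinMap (p : C(unitInterval, ℝ)) : HasFDerivAt sinMap
    (ContinuousLinearMap.mul ℝ C(unitInterval, ℝ) (cosMap p ^ 3)) p := by
  refine (hasFDerivAt_superpose (contDiff_slopeSin.of_le (by simp)) p).congr_fderiv ?_
  congr 1
  ext z
  simp [(hasDerivAt_slopeSin (p z)).deriv]

theorem hasFDerivAt_cosMap (p : C(unitInterval, ℝ)) : HasFDerivAt cosMap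
    (ContinuousLinearMap.mul ℝ C(unitInterval, ℝ) (-(p * cosMap p ^ 3))) p := by
  refine (hasFDerivAt_superpose (contDiff_slopeCos.of_le (by simp)) p).congr_fderiv ?_
  congr 1
  ext z
  simp [(hasDerivAt_slopeCos (p z)).deriv]

/-! ### The cell map: uniqueness and local continuation -/

/-- The integral over `[0, 1]`. -/
noncomputable def unitIntegral : C(unitInterval, ℝ) →L[ℝ] ℝ :=
  (ContinuousMap.evalCLM ℝ (1 : unitInterval)).comp volterra

theorem unitIntegral_apply (u : C(unitInterval, ℝ)) : unitIntegral u = volterra u 1 := rfl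

theorem unitIntegral_pos {u : C(unitInterval, ℝ)} (hu : ∀ z, 0 < u z) : 0 < unitIntegral u :=
  intervalIntegral.intervalIntegral_pos_of_pos
    ((continuous_unitExtend u).intervalIntegrable _ _) (fun _ => hu _) zero_lt_one

theorem exists_eq_zero_of_unitIntegral_eq_zero {u : C(unitInterval, ℝ)}
    (hu : unitIntegral u = 0) : ∃ z, u z = 0 := by
  have h1 : ∃ z, u z ≤ 0 := by
    by_contra! h
    exact (unitIntegral_pos h).ne' hu
  have h2 : ∃ z, 0 ≤ u z := by
    by_contra! h
    have := unitIntegral_pos (u := -u) fun z => neg_pos.2 (h z)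
    rw [map_neg, hu] at this
    simp at this
  exact mem_range_of_exists_le_of_exists_ge u.continuous h1 h2

/-- The unknowns of the cell problem: the slope, the speed, and the initial value of the sine. -/
abbrev CellSpace : Type := C(unitInterval, ℝ) × (ℝ × ℝ)

/-- The cell problem, integrated once, as a map whose zeros are the solutions; `S` is the primitive
of the rate and the first argument is the inverse of the curvature regime. -/
noncomputable def cellMap (S : C(unitInterval, ℝ)) (u : ℝ × CellSpace) : CellSpace :=
  (sinMap u.2.1 - u.2.2.2 • (1 : C(unitInterval, ℝ))
      - u.1 • (S - u.2.2.1 • volterra (cosMap u.2.1)),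
    (S 1 - u.2.2.1 * unitIntegral (cosMap u.2.1), unitIntegral u.2.1))

theorem contDiff_cellMap (S : C(unitInterval, ℝ)) : ContDiff ℝ ∞ (cellMap S) := by
  have h1 := contDiff_sinMap
  have h2 := contDiff_cosMap
  unfold cellMap
  fun_prop

theorem cellMap_eq_zero_iff {S p : C(unitInterval, ℝ)} {μ c e : ℝ} :
    cellMap S (μ, p, c, e) = 0 ↔
      sinMap p = e • 1 + μ • (S - c • volterra (cosMap p)) ∧
        S 1 = c * unitIntegral (cosMap p) ∧ unitIntegral p = 0 := by
  simp only [cellMap, Prod.ext_iff, Prod.fst_zero, Prod.snd_zero, sub_eq_iff_eq_add',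
    add_zero]

theorem cellMap_apply_one {S p : C(unitInterval, ℝ)} {μ c e : ℝ}
    (h : cellMap S (μ, p, c, e) = 0) : sinMap p 1 = e := by
  obtain ⟨h1, h2, h3⟩ := cellMap_eq_zero_iff.1 h
  rw [h1]
  simp only [ContinuousMap.add_apply, ContinuousMap.smul_apply, ContinuousMap.one_apply,
    ContinuousMap.sub_apply, smul_eq_mul, ← unitIntegral_apply]
  rw [h2]; ring

/-- The difference of the sines satisfies a linear periodic equation from which `S` has cancelled.
It vanishes somewhere because `p₁ - p₂` has mean zero. -/
theorem cellMap_solution_unique {S : C(unitInterval, ℝ)} (hS : S 0 = 0) {μ : ℝ} {x y : CellSpace}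
    (hx : cellMap S (μ, x) = 0) (hy : cellMap S (μ, y) = 0) : x = y := by
  obtain ⟨p₁, c₁, e₁⟩ := x
  obtain ⟨p₂, c₂, e₂⟩ := y
  obtain ⟨h1, h1', h1''⟩ := cellMap_eq_zero_iff.1 hx
  obtain ⟨h2, h2', h2''⟩ := cellMap_eq_zero_iff.1 hy
  have hp : p₁ = p₂ := by
    have k : ∀ z, 0 < slopeCos (p₁ z) + slopeCos (p₂ z) := fun z =>
      add_pos (slopeCos_pos _) (slopeCos_pos _)
    -- From `sin² + cos² = 1`, the difference of cosines is minus the difference of sines times this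
    -- quotient, whose denominator is positive.
    let a : C(unitInterval, ℝ) :=
      ⟨fun z => μ * c₁ * ((slopeSin (p₁ z) + slopeSin (p₂ z)) /
        (slopeCos (p₁ z) + slopeCos (p₂ z))),
        continuous_const.mul (((sinMap p₁).continuous.add (sinMap p₂).continuous).div
          ((cosMap p₁).continuous.add (cosMap p₂).continuous) fun z => (k z).ne')⟩
    obtain ⟨z₀, hz₀⟩ := exists_eq_zero_of_unitIntegral_eq_zero (u := p₁ - p₂)
      (by rw [map_sub, h1'', h2'', sub_zero])
    rw [ContinuousMap.sub_apply, sub_eq_zero] at hz₀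
    have hlin : a * (sinMap p₁ - sinMap p₂) + (-(μ * (c₁ - c₂))) • cosMap p₂
        = -μ • (c₁ • cosMap p₁ - c₂ • cosMap p₂) := by
      ext z
      have q1 := slopeSin_sq_add_slopeCos_sq (p₁ z)
      have q2 := slopeSin_sq_add_slopeCos_sq (p₂ z)
      have := (k z).ne'
      simp only [a, ContinuousMap.add_apply, ContinuousMap.mul_apply, ContinuousMap.coe_mk,
        ContinuousMap.sub_apply, sinMap_apply, ContinuousMap.smul_apply, cosMap_apply, smul_eq_mul]
      field_simp
      linear_combination μ * c₁ * (q1 - q2)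
    have := eq_zero_of_linear_periodic (a := a) (β := cosMap p₂) (d := sinMap p₁ - sinMap p₂)
      (e := e₁ - e₂) (γ := -(μ * (c₁ - c₂))) (fun z => slopeCos_pos _) ?_ ?_ (z₀ := z₀) ?_
    · ext z
      have := DFunLike.congr_fun this.2 z
      rw [ContinuousMap.sub_apply, ContinuousMap.zero_apply, sub_eq_zero] at this
      exact slopeSin_strictMono.injective this
    · rw [hlin, map_smul, map_sub, map_smul, map_smul, h1, h2]
      module
    · have g1 := cellMap_apply_one hx
      have g2 := cellMap_apply_one hy
      have g3 : sinMap p₁ 0 = e₁ := by rw [h1]; simp [hS]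
      have g4 : sinMap p₂ 0 = e₂ := by rw [h2]; simp [hS]
      simp only [ContinuousMap.sub_apply, g1, g2, g3, g4]
    · simp [hz₀]
  subst hp
  have hpos : 0 < unitIntegral (cosMap p₁) := unitIntegral_pos fun z => slopeCos_pos _
  have hc : c₁ = c₂ := mul_right_cancel₀ hpos.ne' (h1'.symm.trans h2')
  have he : e₁ = e₂ := (cellMap_apply_one hx).symm.trans (cellMap_apply_one hy)
  rw [hc, he]

theorem exists_hasFDerivAt_cellMap (S p : C(unitInterval, ℝ)) (μ c e : ℝ) :
    ∃ A : CellSpace →L[ℝ] CellSpace, HasFDerivAt (fun x => cellMap S (μ, x)) A (p, c, e) ∧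
      ∀ (q : C(unitInterval, ℝ)) (γ ε : ℝ), A (q, γ, ε) =
        (cosMap p ^ 3 * q - ε • 1 + (μ * γ) • volterra (cosMap p)
          - (μ * c) • volterra (p * (cosMap p ^ 3 * q)),
          (c * unitIntegral (p * (cosMap p ^ 3 * q)) - γ * unitIntegral (cosMap p),
            unitIntegral q)) := by
  have hs : HasFDerivAt (fun x : CellSpace => sinMap x.1) _ (p, c, e) :=
    (hasFDerivAt_sinMap p).comp (p, c, e) hasFDerivAt_fst
  have hk : HasFDerivAt (fun x : CellSpace => cosMap x.1) _ (p, c, e) :=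
    (hasFDerivAt_cosMap p).comp (p, c, e) hasFDerivAt_fst
  have hc : HasFDerivAt (fun x : CellSpace => x.2.1) _ (p, c, e) :=
    (ContinuousLinearMap.fst ℝ ℝ ℝ ∘L ContinuousLinearMap.snd ℝ C(unitInterval, ℝ) (ℝ × ℝ)).hasFDerivAt
  have he : HasFDerivAt (fun x : CellSpace => x.2.2) _ (p, c, e) :=
    (ContinuousLinearMap.snd ℝ ℝ ℝ ∘L ContinuousLinearMap.snd ℝ C(unitInterval, ℝ) (ℝ × ℝ)).hasFDerivAt
  have hV := volterra.hasFDerivAt.comp (p, c, e) hk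
  have hU := unitIntegral.hasFDerivAt.comp (p, c, e) hk
  have hP : HasFDerivAt (fun x : CellSpace => unitIntegral x.1) _ (p, c, e) :=
    unitIntegral.hasFDerivAt.comp (p, c, e) hasFDerivAt_fst
  refine ⟨_, ((hs.sub (he.smul_const (1 : C(unitInterval, ℝ)))).sub
    (((hc.smul hV).const_sub S).const_smul μ)).prodMk
      (((hc.mul hU).const_sub (S 1)).prodMk hP), fun q γ ε => ?_⟩
  simp [mul_assoc]
  refine ⟨?_, ?_⟩
  · module
  · ring

/-- With `y = cos³ q`, a kernel element satisfies `y' = μ c p y - μ γ cos p`, is periodic, and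
vanishes where `q` does; hence it is zero. The block acting on the slope is an invertible
multiplication followed by `1 - volterra (a ·)`, so injectivity suffices. -/
theorem isInvertible_fderiv_cellMap {S p : C(unitInterval, ℝ)} {μ c e : ℝ} :
    (fderiv ℝ (cellMap S) (μ, p, c, e) ∘L .inr ℝ ℝ CellSpace).IsInvertible := by
  obtain ⟨A, hA, hAx⟩ := exists_hasFDerivAt_cellMap S p μ c e
  have hfd : fderiv ℝ (cellMap S) (μ, p, c, e) ∘L .inr ℝ ℝ CellSpace = A := by
    have h1 := (((contDiff_cellMap S).differentiable (by simp)) (μ, p, c, e)).hasFDerivAt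
    exact (h1.comp (p, c, e) (hasFDerivAt_prodMk_right μ (p, c, e))).unique hA
  rw [hfd]
  have hk : ∀ z, 0 < slopeCos (p z) ^ 3 := fun z => pow_pos (slopeCos_pos _) 3
  have hinj : Function.Injective A := by
    rw [← LinearMap.coe_coe, ← LinearMap.ker_eq_bot, LinearMap.ker_eq_bot']
    rintro ⟨q, γ, ε⟩ h
    rw [LinearMap.coe_coe, hAx] at h
    simp only [Prod.ext_iff, Prod.fst_zero, Prod.snd_zero] at h
    obtain ⟨h1, h2, h3⟩ := h
    set y := cosMap p ^ 3 * q with hy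
    obtain ⟨z₀, hz₀⟩ := exists_eq_zero_of_unitIntegral_eq_zero h3
    have hlin : y = ε • 1 + volterra ((μ * c) • p * y + (-(μ * γ)) • cosMap p) := by
      rw [map_add, map_smul, smul_mul_assoc, map_smul]
      linear_combination (exp := 1) h1 - neg_smul (μ * γ) (volterra (cosMap p))
    have hy1 : y 1 = y 0 := by
      have a1 := DFunLike.congr_fun hlin 1
      have a0 := DFunLike.congr_fun hlin 0
      rw [map_add, map_smul, smul_mul_assoc, map_smul] at a1 a0
      simp only [ContinuousMap.add_apply, ContinuousMap.smul_apply, ContinuousMap.one_apply,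
        smul_eq_mul, ← unitIntegral_apply, volterra_zero_apply] at a1 a0
      rw [a0, a1]
      linear_combination μ * h2
    have hy0 := (eq_zero_of_linear_periodic (fun z => slopeCos_pos (p z)) hlin hy1
      (z₀ := z₀) (by simp [hy, hz₀])).2
    have hq : q = 0 := by
      ext z
      have := DFunLike.congr_fun hy0 z
      exact (mul_eq_zero.1 this).resolve_left (hk z).ne'
    have hpos : 0 < unitIntegral (cosMap p) := unitIntegral_pos fun z => slopeCos_pos _
    -- Taken from the periodicity condition, since the linear equation only controls `μ * γ`, which
    -- carries no information at `μ = 0`.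
    have hγ : γ = 0 := by
      rw [hy0, mul_zero, map_zero, mul_zero, zero_sub, neg_eq_zero] at h2
      exact (mul_eq_zero.1 h2).resolve_right hpos.ne'
    have hε : ε = 0 := by
      have := DFunLike.congr_fun h1 0
      simpa [hy0, hγ] using this
    rw [hq, hγ, hε]; rfl
  have hsurj : Function.Surjective A := by
    refine surjective_of_injective_of_block A.toLinearMap ?_ hinj
    let G : C(unitInterval, ℝ) :=
      ⟨fun z => (slopeCos (p z) ^ 3)⁻¹, ((cosMap p).continuous.pow 3).inv₀ fun z => (hk z).ne'⟩
    have hG : cosMap p ^ 3 * G = 1 := by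
      ext z
      exact mul_inv_cancel₀ (hk z).ne'
    have hmul : Function.Bijective fun q : C(unitInterval, ℝ) => cosMap p ^ 3 * q :=
      IsUnit.isUnit_iff_mulLeft_bijective.1 (IsUnit.of_mul_eq_one G hG)
    refine (funext fun q => ?_ : (fun q => (A (q, 0)).1) =
      (fun y : C(unitInterval, ℝ) => y - volterra ((μ * c) • p * y)) ∘ _) ▸
        (bijective_sub_volterra ((μ * c) • p)).comp hmul
    have := congrArg Prod.fst (hAx q 0 0)
    simp only [mul_zero, zero_smul, add_zero, sub_zero] at this
    simp only [Function.comp, smul_mul_assoc, map_smul]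
    exact this
  exact ⟨ContinuousLinearEquiv.ofBijective A (LinearMap.ker_eq_bot.2 hinj)
    (LinearMap.range_eq_top.2 hsurj), rfl⟩

theorem exists_contDiffAt_cellMap_eq_zero {S : C(unitInterval, ℝ)} {μ : ℝ} {x : CellSpace}
    (h : cellMap S (μ, x) = 0) : ∃ φ : ℝ → CellSpace, ContDiffAt ℝ ∞ φ μ ∧
      ∀ᶠ ν in 𝓝 μ, cellMap S (ν, φ ν) = 0 := by
  obtain ⟨p, c, e⟩ := x
  have hd : ContDiffAt ℝ ∞ (cellMap S) (μ, p, c, e) := (contDiff_cellMap S).contDiffAt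
  refine ⟨_, hd.contDiffAt_implicitFunction (by simp) isInvertible_fderiv_cellMap, ?_⟩
  have := hd.eventually_apply_implicitFunction (by simp) isInvertible_fderiv_cellMap
  rwa [h] at this

/-! ### Periodic slopes and a priori bounds -/

/-- A measurable `1`-periodic function with values almost everywhere between two positive
constants. -/
structure IsBoundedRate (ρ : ℝ → ℝ) (m M : ℝ) : Prop where
  aemeasurable : AEMeasurable ρ volume
  periodic : Function.Periodic ρ 1
  lower_pos : 0 < m
  bounds : ∀ᵐ z : ℝ, m ≤ ρ z ∧ ρ z ≤ M

namespace IsBoundedRate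

variable {ρ : ℝ → ℝ} {m M : ℝ}

theorem le (h : IsBoundedRate ρ m M) : m ≤ M := by
  obtain ⟨z, hz⟩ := h.bounds.exists
  exact hz.1.trans hz.2

theorem upper_pos (h : IsBoundedRate ρ m M) : 0 < M := h.lower_pos.trans_le h.le

theorem norm_le (h : IsBoundedRate ρ m M) : ∀ᵐ z : ℝ, ‖ρ z‖ ≤ M := by
  filter_upwards [h.bounds] with z hz
  rw [Real.norm_of_nonneg (h.lower_pos.le.trans hz.1)]
  exact hz.2

theorem locallyIntegrable (h : IsBoundedRate ρ m M) : LocallyIntegrable ρ volume :=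
  (memLp_top_of_bound h.aemeasurable.aestronglyMeasurable M h.norm_le).locallyIntegrable le_top

theorem intervalIntegrable (h : IsBoundedRate ρ m M) (a b : ℝ) :
    IntervalIntegrable ρ volume a b :=
  (h.locallyIntegrable.integrableOn_isCompact isCompact_uIcc).intervalIntegrable

/-- The primitive of the rate on `[0, 1]`. -/
noncomputable def primitive (h : IsBoundedRate ρ m M) : C(unitInterval, ℝ) :=
  ⟨fun z => ∫ t in (0 : ℝ)..z, ρ t,
    (intervalIntegral.continuous_primitive h.intervalIntegrable 0).comp continuous_subtype_val⟩

theorem primitive_apply (h : IsBoundedRate ρ m M) (z : unitInterval) :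
    h.primitive z = ∫ t in (0 : ℝ)..z, ρ t := rfl

theorem primitive_zero (h : IsBoundedRate ρ m M) : h.primitive 0 = 0 := by
  simp [primitive_apply]

theorem primitive_one (h : IsBoundedRate ρ m M) : h.primitive 1 = ∫ t in (0 : ℝ)..1, ρ t := rfl

theorem le_primitive_one (h : IsBoundedRate ρ m M) : m ≤ h.primitive 1 := by
  have := intervalIntegral.integral_mono_ae zero_le_one intervalIntegrable_const
    (h.intervalIntegrable 0 1) (h.bounds.mono fun z hz => hz.1)
  simpa [primitive_one] using this

theorem primitive_one_le (h : IsBoundedRate ρ m M) : h.primitive 1 ≤ M := by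
  have := intervalIntegral.integral_mono_ae zero_le_one
    (h.intervalIntegrable 0 1) intervalIntegrable_const (h.bounds.mono fun z hz => hz.2)
  simpa [primitive_one] using this

end IsBoundedRate

/-- `P` is the periodic slope of a solution of the cell problem of speed `c`, `μ` being the inverse
of the curvature regime. -/
structure IsCellSlope (ρ : ℝ → ℝ) (μ c : ℝ) (P : ℝ → ℝ) : Prop where
  continuous : Continuous P
  periodic : Function.Periodic P 1
  integral_eq_zero : ∫ t in (0 : ℝ)..1, P t = 0
  sin_sub : ∀ x y, slopeSin (P y) - slopeSin (P x) = ∫ t in x..y, μ * (ρ t - c * slopeCos (P t))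

theorem Function.Periodic.eq_fract {f : ℝ → ℝ} (hf : Function.Periodic f 1) (x : ℝ) :
    f (Int.fract x) = f x := by
  have := hf.sub_int_mul_eq (x := x) ⌊x⌋
  rwa [mul_one] at this

theorem Function.Periodic.exists_forall_le {f : ℝ → ℝ} (hf : Function.Periodic f 1)
    (hc : Continuous f) : ∃ z, ∀ x, f x ≤ f z := by
  obtain ⟨z, -, hz⟩ := (isCompact_Icc (a := (0 : ℝ)) (b := 1)).exists_isMaxOn
    (nonempty_Icc.2 zero_le_one) hc.continuousOn
  exact ⟨z, fun x => hf.eq_fract x ▸ hz ⟨Int.fract_nonneg x, (Int.fract_lt_one x).le⟩⟩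

theorem intervalIntegrable_cell {ρ P : ℝ → ℝ} {m M : ℝ} (hρ : IsBoundedRate ρ m M)
    (hP : Continuous P) (μ c a b : ℝ) :
    IntervalIntegrable (fun t => μ * (ρ t - c * slopeCos (P t))) volume a b :=
  ((hρ.intervalIntegrable a b).sub ((continuous_const.mul
    (contDiff_slopeCos.continuous.comp hP)).intervalIntegrable a b)).const_mul μ

theorem integral_cell {ρ P : ℝ → ℝ} {m M : ℝ} (hρ : IsBoundedRate ρ m M) (hP : Continuous P)
    {p : C(unitInterval, ℝ)} (hp : ∀ t ∈ Icc (0 : ℝ) 1, P t = unitExtend p t) (μ c : ℝ)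
    (z : unitInterval) : ∫ t in (0 : ℝ)..z, μ * (ρ t - c * slopeCos (P t)) =
      μ * (hρ.primitive z - c * volterra (cosMap p) z) := by
  have hint : IntervalIntegrable (fun t => c * slopeCos (P t)) volume 0 z :=
    (continuous_const.mul (contDiff_slopeCos.continuous.comp hP)).intervalIntegrable _ _
  rw [intervalIntegral.integral_const_mul,
    intervalIntegral.integral_sub (hρ.intervalIntegrable _ _) hint,
    intervalIntegral.integral_const_mul, hρ.primitive_apply, volterra_apply,
    intervalIntegral.integral_congr (f := fun t => slopeCos (P t))
      (g := unitExtend (cosMap p))]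
  intro t ht
  rw [uIcc_of_le z.2.1] at ht
  have ht' : t ∈ Icc (0 : ℝ) 1 := ⟨ht.1, ht.2.trans z.2.2⟩
  simp only [hp t ht', unitExtend_of_mem _ ht', cosMap_apply]

/-- The end sines are both `e`, so injectivity of the sine closes `p` up to a continuous periodic
function. The integrand has mean zero over a period, which carries the integrated equation to all of
`ℝ`. -/
theorem isCellSlope_of_cellMap_eq_zero {ρ : ℝ → ℝ} {m M : ℝ} (hρ : IsBoundedRate ρ m M)
    {μ c e : ℝ} {p : C(unitInterval, ℝ)} (h : cellMap hρ.primitive (μ, p, c, e) = 0) :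
    IsCellSlope ρ μ c fun x => unitExtend p (Int.fract x) := by
  have h1' := cellMap_apply_one h
  obtain ⟨h1, h2, h3⟩ := cellMap_eq_zero_iff.1 h
  have h10 : sinMap p 0 = e := by rw [h1]; simp [hρ.primitive_zero]
  have hp : p 0 = p 1 := slopeSin_strictMono.injective (h10.trans h1'.symm)
  set P : ℝ → ℝ := fun x => unitExtend p (Int.fract x) with hPdef
  have hper : Function.Periodic P 1 := fun x => by simp [P]
  have hcont : Continuous P :=
    (continuous_unitExtend p).continuousOn.comp_fract'' (by
      rw [unitExtend_of_mem p ⟨le_rfl, zero_le_one⟩, unitExtend_of_mem p ⟨zero_le_one, le_rfl⟩]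
      exact hp)
  have hP01 : ∀ x : unitInterval, P x = p x := by
    intro x
    rcases x.2.2.lt_or_eq with hx | hx
    · rw [hPdef]
      simp only [Int.fract_eq_self.2 ⟨x.2.1, hx⟩, unitExtend_coe]
    · have hx1 : x = 1 := Subtype.ext hx
      have := hper 0
      rw [zero_add] at this
      subst hx1
      rw [← hp, Set.Icc.coe_one, this]
      simp only [P, Int.fract_zero]
      exact unitExtend_of_mem p ⟨le_rfl, zero_le_one⟩
  have hPext : ∀ t ∈ Icc (0 : ℝ) 1, P t = unitExtend p t := fun t ht => by
    rw [unitExtend_of_mem p ht]; exact hP01 ⟨t, ht⟩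
  have hii := intervalIntegrable_cell hρ hcont μ c
  have hD : ∀ z : unitInterval,
      slopeSin (P z) = e + ∫ t in (0 : ℝ)..z, μ * (ρ t - c * slopeCos (P t)) := by
    intro z
    have := DFunLike.congr_fun h1 z
    rw [hP01, ← sinMap_apply, this, integral_cell hρ hcont hPext]
    simp
  have hfper : Function.Periodic (fun t => μ * (ρ t - c * slopeCos (P t))) 1 := fun t => by
    simp only [hper t, hρ.periodic t]
  have hf1 : ∫ t in (0 : ℝ)..1, μ * (ρ t - c * slopeCos (P t)) = 0 := by
    have := hD 1
    rw [hP01, ← sinMap_apply, h1'] at this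
    simpa using this
  have hDper : Function.Periodic
      (fun x => slopeSin (P x) - ∫ t in (0 : ℝ)..x, μ * (ρ t - c * slopeCos (P t))) 1 := by
    intro x
    simp only [hper x]
    rw [← intervalIntegral.integral_add_adjacent_intervals (hii 0 x) (hii x (x + 1)),
      hfper.intervalIntegral_add_eq x 0, zero_add, hf1, add_zero]
  have hD' : ∀ x, slopeSin (P x) = e + ∫ t in (0 : ℝ)..x, μ * (ρ t - c * slopeCos (P t)) := by
    intro x
    have a1 := hDper.eq_fract x
    have a2 := hD ⟨Int.fract x, Int.fract_nonneg x, (Int.fract_lt_one x).le⟩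
    simp only at a1 a2
    rw [a2] at a1
    linarith
  refine ⟨hcont, hper, ?_, fun x y => ?_⟩
  · refine Eq.trans ?_ h3
    rw [unitIntegral_apply, volterra_apply]
    exact intervalIntegral.integral_congr fun t ht => hPext t (by rwa [uIcc_of_le zero_le_one] at ht)
  · rw [hD' x, hD' y, ← intervalIntegral.integral_add_adjacent_intervals (hii 0 x) (hii x y)]
    ring

/-- The restriction of a continuous function to `[0, 1]`. -/
def unitRestrict (P : ℝ → ℝ) (hP : Continuous P) : C(unitInterval, ℝ) :=
  ⟨fun z => P z, hP.comp continuous_subtype_val⟩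

namespace IsCellSlope

variable {ρ : ℝ → ℝ} {m M μ c : ℝ} {P : ℝ → ℝ}

/-- `μ ≠ 0` is needed because at `μ = 0` the slope equation does not determine `c`. -/
theorem cellMap_eq_zero (h : IsCellSlope ρ μ c P) (hρ : IsBoundedRate ρ m M) (hμ : μ ≠ 0) :
    cellMap hρ.primitive (μ, unitRestrict P h.continuous, c, slopeSin (P 0)) = 0 := by
  set p := unitRestrict P h.continuous with hp
  have hint := integral_cell hρ h.continuous
    (fun t ht => (unitExtend_of_mem p ht).symm) μ c
  refine cellMap_eq_zero_iff.2 ⟨?_, ?_, ?_⟩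
  · ext z
    have := h.sin_sub 0 z
    rw [hint] at this
    simp only [sinMap_apply, ContinuousMap.add_apply, ContinuousMap.smul_apply,
      ContinuousMap.one_apply, ContinuousMap.sub_apply, smul_eq_mul, mul_one]
    rw [← this]
    simp [hp, unitRestrict]
  · have := h.sin_sub 0 1
    have h1 := h.periodic 0
    rw [zero_add] at h1
    rw [h1, sub_self] at this
    have h2 := (hint 1).symm.trans this.symm
    have h3 := (mul_eq_zero.1 h2).resolve_left hμ
    rw [unitIntegral_apply]
    linarith
  · rw [← h.integral_eq_zero, unitIntegral_apply, volterra_apply]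
    refine intervalIntegral.integral_congr fun t ht => ?_
    rw [uIcc_of_le (by simp)] at ht
    exact unitExtend_of_mem p ht

theorem unique (hρ : IsBoundedRate ρ m M) (hμ : μ ≠ 0) {c' : ℝ} {P' : ℝ → ℝ}
    (h : IsCellSlope ρ μ c P) (h' : IsCellSlope ρ μ c' P') : c = c' ∧ P = P' := by
  have := cellMap_solution_unique hρ.primitive_zero (h.cellMap_eq_zero hρ hμ)
    (h'.cellMap_eq_zero hρ hμ)
  refine ⟨congrArg (fun x => x.2.1) this, funext fun x => ?_⟩
  have hx := DFunLike.congr_fun (congrArg Prod.fst this)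
    ⟨Int.fract x, Int.fract_nonneg x, (Int.fract_lt_one x).le⟩
  rw [← h.periodic.eq_fract x, ← h'.periodic.eq_fract x]
  exact hx

/-- Where `c cos P < m ≤ ρ`, the derivative of the sine is positive, uniformly near `z` by
continuity. -/
theorem exists_lt_of_lt (h : IsCellSlope ρ μ c P) (hρ : IsBoundedRate ρ m M) (hμ : 0 < μ) {z : ℝ}
    (hz : c * slopeCos (P z) < m) :
    ∃ δ > 0, ∀ x y, |x - z| < δ → |y - z| < δ → x < y → P x < P y := by
  obtain ⟨r, hr1, hr2⟩ := exists_between hz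
  have hcont : Continuous fun t => c * slopeCos (P t) :=
    continuous_const.mul (contDiff_slopeCos.continuous.comp h.continuous)
  obtain ⟨δ, hδ, hδ'⟩ := Metric.eventually_nhds_iff.1 (hcont.continuousAt.eventually_lt_const hr1)
  refine ⟨δ, hδ, fun x y hx hy hxy => slopeSin_strictMono.lt_iff_lt.1 (sub_pos.1 ?_)⟩
  rw [h.sin_sub]
  refine lt_of_lt_of_le (?_ : 0 < (y - x) * (μ * (m - r))) ?_
  · have := sub_pos.2 hxy
    have := sub_pos.2 hr2
    positivity
  rw [← smul_eq_mul, ← intervalIntegral.integral_const]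
  refine intervalIntegral.integral_mono_ae_restrict hxy.le intervalIntegrable_const
    (intervalIntegrable_cell hρ h.continuous _ _ _ _) ?_
  filter_upwards [ae_restrict_mem measurableSet_Icc, ae_restrict_of_ae hρ.bounds] with t ht ht'
  have : c * slopeCos (P t) < r := hδ' (by
    rw [Real.dist_eq, abs_lt]
    rw [abs_lt] at hx hy
    constructor <;> linarith [ht.1, ht.2])
  exact mul_le_mul_of_nonneg_left (by linarith [ht'.1]) hμ.le

theorem exists_gt_of_lt (h : IsCellSlope ρ μ c P) (hρ : IsBoundedRate ρ m M) (hμ : 0 < μ) {z : ℝ}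
    (hz : M < c * slopeCos (P z)) :
    ∃ δ > 0, ∀ x y, |x - z| < δ → |y - z| < δ → x < y → P y < P x := by
  obtain ⟨r, hr1, hr2⟩ := exists_between hz
  have hcont : Continuous fun t => c * slopeCos (P t) :=
    continuous_const.mul (contDiff_slopeCos.continuous.comp h.continuous)
  obtain ⟨δ, hδ, hδ'⟩ := Metric.eventually_nhds_iff.1 (hcont.continuousAt.eventually_const_lt hr2)
  refine ⟨δ, hδ, fun x y hx hy hxy => slopeSin_strictMono.lt_iff_lt.1 (sub_neg.1 ?_)⟩
  rw [h.sin_sub]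
  refine lt_of_le_of_lt (?_ : _ ≤ (y - x) * (μ * (M - r))) ?_
  · rw [← smul_eq_mul, ← intervalIntegral.integral_const]
    refine intervalIntegral.integral_mono_ae_restrict hxy.le
      (intervalIntegrable_cell hρ h.continuous _ _ _ _) intervalIntegrable_const ?_
    filter_upwards [ae_restrict_mem measurableSet_Icc, ae_restrict_of_ae hρ.bounds] with t ht ht'
    have : r < c * slopeCos (P t) := hδ' (by
      rw [Real.dist_eq, abs_lt]
      rw [abs_lt] at hx hy
      constructor <;> linarith [ht.1, ht.2])
    exact mul_le_mul_of_nonneg_left (by linarith [ht'.2]) hμ.le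
  · exact mul_neg_of_pos_of_neg (sub_pos.2 hxy) (mul_neg_of_pos_of_neg hμ (by linarith))

/-- Here `-∫ P` is periodic and has a maximum, where `P = 0` and the cosine is `1`. If `c > M`, then
`P` decreases strictly there and is negative just to the right, so `-∫ P` rises above its maximum.
-/
theorem speed_le (h : IsCellSlope ρ μ c P) (hρ : IsBoundedRate ρ m M) (hμ : 0 < μ) : c ≤ M := by
  by_contra! hc
  have hii := fun a b => h.continuous.intervalIntegrable (μ := volume) a b
  have hWd : ∀ x, HasDerivAt (fun x => -∫ t in (0 : ℝ)..x, P t) (-P x) x := fun x =>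
    (intervalIntegral.integral_hasDerivAt_right (hii 0 x)
      (h.continuous.stronglyMeasurableAtFilter _ _) h.continuous.continuousAt).neg
  have hWper : Function.Periodic (fun x => -∫ t in (0 : ℝ)..x, P t) 1 := fun x => by
    simp only
    rw [← intervalIntegral.integral_add_adjacent_intervals (hii 0 x) (hii x (x + 1)),
      h.periodic.intervalIntegral_add_eq x 0, zero_add, h.integral_eq_zero, add_zero]
  obtain ⟨z, hz⟩ := hWper.exists_forall_le
    (continuous_iff_continuousAt.2 fun x => (hWd x).continuousAt)
  have hmax : IsLocalMax (fun x => -∫ t in (0 : ℝ)..x, P t) z := Eventually.of_forall hz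
  have hPz : P z = 0 := neg_eq_zero.1 (hmax.hasDerivAt_eq_zero (hWd z))
  obtain ⟨δ, hδ, hδ'⟩ := h.exists_gt_of_lt hρ hμ (z := z) (by simpa [hPz] using hc)
  have hneg : 0 < ∫ t in z..z + δ / 2, -P t := by
    refine intervalIntegral.intervalIntegral_pos_of_pos_on ((hii _ _).neg) (fun t ht => ?_)
      (by linarith)
    have := hδ' z t (by simpa using hδ) (by rw [abs_lt]; constructor <;> linarith [ht.1, ht.2]) ht.1
    linarith
  have h1 := hz (z + δ / 2)
  rw [← intervalIntegral.integral_add_adjacent_intervals (hii 0 z) (hii z (z + δ / 2))] at h1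
  rw [intervalIntegral.integral_neg] at hneg
  linarith

/-- Since `cos P ≤ 1 / |P|` and `c ≤ M`, a value `|P| > M / m` would give `c cos P < m`. Then `P`
would be strictly increasing there, which is impossible at an extremum. -/
theorem abs_le_of_pos (h : IsCellSlope ρ μ c P) (hρ : IsBoundedRate ρ m M) (hμ : 0 < μ)
    (x : ℝ) : |P x| ≤ M / m := by
  have hc := h.speed_le hρ hμ
  have key : ∀ z, M / m < |P z| → c * slopeCos (P z) < m := by
    intro z hz
    have h1 := slopeCos_pos (P z)
    have h2 : |P z| * slopeCos (P z) ≤ 1 := by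
      have := abs_slopeSin_le_one (P z)
      rwa [slopeSin, abs_mul, abs_of_pos h1] at this
    rw [div_lt_iff₀ hρ.lower_pos] at hz
    have h3 : M * slopeCos (P z) < |P z| * m * slopeCos (P z) := mul_lt_mul_of_pos_right hz h1
    have h4 := mul_le_mul_of_nonneg_left h2 hρ.lower_pos.le
    have h5 := mul_le_mul_of_nonneg_right hc h1.le
    linarith
  rw [abs_le]
  constructor
  · obtain ⟨z, hz⟩ := Function.Periodic.exists_forall_le (f := fun x => -P x)
      (fun x => by simp only [h.periodic x]) h.continuous.neg
    suffices -(M / m) ≤ P z by have := hz x; linarith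
    by_contra! hlt
    obtain ⟨δ, hδ, hδ'⟩ := h.exists_lt_of_lt hρ hμ (key z (lt_abs.2 (Or.inr (by linarith))))
    have := hδ' (z - δ / 2) z (by rw [abs_lt]; constructor <;> linarith) (by simpa using hδ)
      (by linarith)
    have := hz (z - δ / 2)
    linarith
  · obtain ⟨z, hz⟩ := h.periodic.exists_forall_le h.continuous
    refine (hz x).trans ?_
    by_contra! hlt
    obtain ⟨δ, hδ, hδ'⟩ := h.exists_lt_of_lt hρ hμ (key z (lt_abs.2 (Or.inl hlt)))
    have := hδ' z (z + δ / 2) (by simpa using hδ) (by rw [abs_lt]; constructor <;> linarith)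
      (by linarith)
    have := hz (z + δ / 2)
    linarith

end IsCellSlope

theorem slopeCos_le_of_abs_le {p Q : ℝ} (h : |p| ≤ Q) : slopeCos Q ≤ slopeCos p := by
  have hQ : p ^ 2 ≤ Q ^ 2 := sq_le_sq.2 (h.trans (le_abs_self Q))
  exact inv_anti₀ (by positivity) (Real.sqrt_le_sqrt (by linarith))

theorem abs_sub_le_of_slopeSin {p q Q : ℝ} (hp : |p| ≤ Q) (hq : |q| ≤ Q) :
    slopeCos Q ^ 3 * |p - q| ≤ |slopeSin p - slopeSin q| := by
  wlog hpq : q ≤ p generalizing p q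
  · rw [abs_sub_comm p, abs_sub_comm (slopeSin p)]
    exact this hq hp (le_of_not_ge hpq)
  rw [abs_of_nonneg (sub_nonneg.2 hpq),
    abs_of_nonneg (sub_nonneg.2 (slopeSin_strictMono.monotone hpq))]
  refine (convex_Icc (-Q) Q).mul_sub_le_image_sub_of_le_deriv
    contDiff_slopeSin.continuous.continuousOn
    (contDiff_slopeSin.differentiable (by simp)).differentiableOn (fun t ht => ?_)
    q (abs_le.1 hq) p (abs_le.1 hp) hpq
  rw [(hasDerivAt_slopeSin t).deriv]
  rw [interior_Icc] at ht
  exact pow_le_pow_left₀ (slopeCos_pos Q).le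
    (slopeCos_le_of_abs_le (abs_le.2 ⟨ht.1.le, ht.2.le⟩)) 3

/-- Reflection `w ↦ -w` exchanges `μ` and `-μ`; it transfers the bounds to negative `μ`. -/
theorem cellMap_neg {S p : C(unitInterval, ℝ)} {μ c e : ℝ} (h : cellMap S (μ, p, c, e) = 0) :
    cellMap S (-μ, -p, c, -e) = 0 := by
  obtain ⟨h1, h2, h3⟩ := cellMap_eq_zero_iff.1 h
  have hs : sinMap (-p) = -sinMap p := by ext z; simp [slopeSin_neg]
  have hc : cosMap (-p) = cosMap p := by ext z; simp [slopeCos_neg]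
  refine cellMap_eq_zero_iff.2 ⟨?_, ?_, ?_⟩
  · rw [hs, hc, h1]; module
  · rw [hc, h2]
  · rw [map_neg, h3, neg_zero]

theorem cellMap_zero {S : C(unitInterval, ℝ)} : cellMap S (0, 0, S 1, 0) = 0 := by
  have hs : sinMap 0 = 0 := by ext z; simp
  have hc : cosMap 0 = 1 := by ext z; simp
  refine cellMap_eq_zero_iff.2 ⟨?_, ?_, map_zero _⟩
  · rw [hs]; simp
  · have h1 : unitExtend 1 = fun _ => 1 := rfl
    rw [hc, unitIntegral_apply, volterra_apply, h1]; simp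

/-- The lower bound is `m ≤ S 1 = c ∫ cos p ≤ c`. The others come from extrema when `μ > 0`, from
reflection when `μ < 0`, and from the flat solution when `μ = 0`. -/
theorem cellMap_solution_bounds {ρ : ℝ → ℝ} {m M : ℝ} (hρ : IsBoundedRate ρ m M)
    {μ c e : ℝ} {p : C(unitInterval, ℝ)} (h : cellMap hρ.primitive (μ, p, c, e) = 0) :
    c ∈ Icc m M ∧ ∀ z, |p z| ≤ M / m := by
  have hM := hρ.upper_pos
  have hlow : m ≤ c := by
    obtain ⟨-, h2, -⟩ := cellMap_eq_zero_iff.1 h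
    have hpos : 0 < unitIntegral (cosMap p) := unitIntegral_pos fun z => slopeCos_pos _
    have hle : unitIntegral (cosMap p) ≤ 1 := by
      have := intervalIntegral.norm_integral_le_of_norm_le_const (a := 0) (b := 1) (C := 1)
        (f := unitExtend (cosMap p)) fun t _ => by
          rw [Real.norm_of_nonneg (r := unitExtend (cosMap p) t) (slopeCos_pos _).le]
          exact slopeCos_le_one _
      simp only [sub_zero, abs_one, mul_one] at this
      exact (le_abs_self _).trans this
    have h3 := hρ.le_primitive_one
    rw [h2] at h3
    have hc : 0 < c := pos_of_mul_pos_left (hρ.lower_pos.trans_le h3) hpos.le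
    exact h3.trans (mul_le_of_le_one_right hc.le hle)
  have hpos : ∀ {μ e : ℝ} {p : C(unitInterval, ℝ)}, 0 < μ →
      cellMap hρ.primitive (μ, p, c, e) = 0 → c ≤ M ∧ ∀ z, |p z| ≤ M / m := by
    intro μ e p hμ h
    have hs := isCellSlope_of_cellMap_eq_zero hρ h
    refine ⟨hs.speed_le hρ hμ, fun z => ?_⟩
    have hz := fun x => hs.abs_le_of_pos hρ hμ x
    have hcl : IsClosed {x : ℝ | |unitExtend p x| ≤ M / m} :=
      isClosed_le (continuous_unitExtend p).abs continuous_const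
    -- The periodic extension uses `Int.fract`, hence shows `p` only on `[0, 1)`; the endpoint
    -- follows by closure.
    have hsub : Icc (0 : ℝ) 1 ⊆ {x : ℝ | |unitExtend p x| ≤ M / m} := by
      rw [← closure_Ico (zero_ne_one (α := ℝ))]
      refine hcl.closure_subset_iff.2 fun x hx => ?_
      have := hz x
      rwa [Int.fract_eq_self.2 hx] at this
    have := hsub z.2
    rwa [mem_ofPred_eq, unitExtend_coe] at this
  rcases lt_trichotomy μ 0 with hμ | hμ | hμ
  · obtain ⟨h1, h2⟩ := hpos (neg_pos.2 hμ) (cellMap_neg h)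
    exact ⟨⟨hlow, h1⟩, fun z => by simpa using h2 z⟩
  · subst hμ
    have := cellMap_solution_unique hρ.primitive_zero h cellMap_zero
    simp only [Prod.mk.injEq] at this
    obtain ⟨rfl, rfl, -⟩ := this
    refine ⟨⟨hlow, hρ.primitive_one_le⟩, fun z => ?_⟩
    have := hρ.lower_pos
    simp only [ContinuousMap.zero_apply, abs_zero]
    positivity
  · obtain ⟨h1, h2⟩ := hpos hμ h
    exact ⟨⟨hlow, h1⟩, h2⟩

theorem IsCellSlope.abs_sub_le {ρ : ℝ → ℝ} {m M μ c Q : ℝ} {P : ℝ → ℝ} (h : IsCellSlope ρ μ c P)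
    (hρ : IsBoundedRate ρ m M) (hc : c ∈ Icc m M) (hP : ∀ x, |P x| ≤ Q) (x y : ℝ) :
    |P y - P x| ≤ |μ| * (2 * M) / slopeCos Q ^ 3 * |y - x| := by
  have hk := pow_pos (slopeCos_pos Q) 3
  rw [div_mul_eq_mul_div, le_div_iff₀ hk, mul_comm]
  refine (abs_sub_le_of_slopeSin (hP y) (hP x)).trans ?_
  rw [h.sin_sub x y]
  refine intervalIntegral.norm_integral_le_of_norm_le_const_ae (E := ℝ) ?_
  filter_upwards [hρ.bounds] with t ht _
  rw [norm_mul, Real.norm_eq_abs, Real.norm_eq_abs]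
  refine mul_le_mul_of_nonneg_left ?_ (abs_nonneg μ)
  have h1 := slopeCos_pos (P t)
  have h2 := slopeCos_le_one (P t)
  have h3 := hρ.lower_pos
  have h4 : c * slopeCos (P t) ≤ M := (mul_le_of_le_one_right (by linarith [hc.1]) h2).trans hc.2
  have h5 : 0 ≤ c * slopeCos (P t) := mul_nonneg (by linarith [hc.1]) h1.le
  rw [abs_le]
  constructor <;> linarith [ht.1, ht.2]

/-! ### Compactness and global continuation -/

theorem isCompact_setOf_bounded_lipschitz (Q L : ℝ) :
    IsCompact {p : C(unitInterval, ℝ) | (∀ z, |p z| ≤ Q) ∧ ∀ x y, |p y - p x| ≤ L * |(y : ℝ) - x|} := by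
  set A := {p : C(unitInterval, ℝ) | (∀ z, |p z| ≤ Q) ∧ ∀ x y, |p y - p x| ≤ L * |(y : ℝ) - x|}
  refine ArzelaAscoli.isCompact_of_equicontinuous A ?_ ?_
  · have himg : ContinuousMap.toFun '' A = (Set.univ.pi fun _ => Icc (-Q) Q) ∩
        {f : unitInterval → ℝ | ∀ x y, |f y - f x| ≤ L * |(y : ℝ) - x|} := by
      ext f
      constructor
      · rintro ⟨p, hp, rfl⟩
        exact ⟨fun z _ => abs_le.1 (hp.1 z), hp.2⟩
      · rintro ⟨h1, h2⟩
        have hf : LipschitzWith (Real.toNNReal L) f := by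
          refine LipschitzWith.of_dist_le_mul fun x y => ?_
          rw [Real.dist_eq, abs_sub_comm]
          refine (h2 x y).trans ?_
          rw [Subtype.dist_eq, Real.dist_eq, abs_sub_comm (y : ℝ)]
          exact mul_le_mul_of_nonneg_right (Real.le_coe_toNNReal L) (abs_nonneg _)
        exact ⟨⟨f, hf.continuous⟩, ⟨fun z => abs_le.2 (h1 z (mem_univ z)), h2⟩, rfl⟩
    rw [himg]
    refine (isCompact_univ_pi fun _ => isCompact_Icc).inter_right ?_
    simp only [ofPred_forall]
    exact isClosed_iInter fun x => isClosed_iInter fun y =>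
      isClosed_le (by fun_prop) continuous_const
  · refine LipschitzWith.uniformEquicontinuous (K := Real.toNNReal L) _ (fun p => ?_)
      |>.equicontinuous
    refine LipschitzWith.of_dist_le_mul fun x y => ?_
    rw [Real.dist_eq, abs_sub_comm]
    refine (p.2.2 x y).trans ?_
    rw [Subtype.dist_eq, Real.dist_eq, abs_sub_comm (y : ℝ)]
    exact mul_le_mul_of_nonneg_right (Real.le_coe_toNNReal L) (abs_nonneg _)

/-- For `|μ| ≤ N` all solutions lie in one compact set, so the solvable parameters are the
projection of a compact zero set. -/
theorem isClosed_setOf_solvable {ρ : ℝ → ℝ} {m M : ℝ} (hρ : IsBoundedRate ρ m M) (N : ℝ) :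
    IsClosed {μ | |μ| ≤ N ∧ ∃ x, cellMap hρ.primitive (μ, x) = 0} := by
  set L := N * (2 * M) / slopeCos (M / m) ^ 3
  let K : Set (ℝ × CellSpace) := Icc (-N) N ×ˢ
    ({p : C(unitInterval, ℝ) | (∀ z, |p z| ≤ M / m) ∧ ∀ x y, |p y - p x| ≤ L * |(y : ℝ) - x|} ×ˢ
      (Icc m M ×ˢ Icc (-1) 1))
  have hK : IsCompact K := isCompact_Icc.prod
    ((isCompact_setOf_bounded_lipschitz _ _).prod (isCompact_Icc.prod isCompact_Icc))
  have hZ : IsClosed {u | cellMap hρ.primitive u = 0} :=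
    isClosed_eq (contDiff_cellMap _).continuous continuous_const
  have himg : {μ | |μ| ≤ N ∧ ∃ x, cellMap hρ.primitive (μ, x) = 0} =
      Prod.fst '' (K ∩ {u | cellMap hρ.primitive u = 0}) := by
    ext μ
    constructor
    · rintro ⟨hμ, ⟨p, c, e⟩, hx⟩
      refine ⟨(μ, p, c, e), ⟨⟨abs_le.1 hμ, ?_⟩, hx⟩, rfl⟩
      obtain ⟨hc, hp⟩ := cellMap_solution_bounds hρ hx
      refine ⟨⟨hp, ?_⟩, hc, ?_⟩
      · have hs := isCellSlope_of_cellMap_eq_zero hρ hx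
        have hlip := hs.abs_sub_le hρ hc (Q := M / m) (fun x => hp _)
        -- `Int.fract` sends `1` to `0`, so the Lipschitz bound is first available on `[0, 1)`. It
        -- is extended by closure in `y`, and then in `x`.
        have hcl : ∀ x : ℝ, x ∈ Ico (0 : ℝ) 1 → ∀ y ∈ Icc (0 : ℝ) 1,
            |unitExtend p y - unitExtend p x| ≤ L * |y - x| := by
          intro x hx y hy
          rw [← closure_Ico (zero_ne_one (α := ℝ))] at hy
          refine (isClosed_le (f := fun y => |unitExtend p y - unitExtend p x|)
            (g := fun y => L * |y - x|) ?_ ?_).closure_subset_iff.2 (fun y hy => ?_) hy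
          · exact ((continuous_unitExtend p).sub continuous_const).abs
          · fun_prop
          · have := hlip x y
            simp only [Int.fract_eq_self.2 hx, Int.fract_eq_self.2 hy] at this
            have hM := hρ.upper_pos
            have hk := slopeCos_pos (M / m)
            exact this.trans (by simp only [L]; gcongr)
        have hcl' : ∀ y ∈ Icc (0 : ℝ) 1, ∀ x ∈ Icc (0 : ℝ) 1,
            |unitExtend p y - unitExtend p x| ≤ L * |y - x| := by
          intro y hy x hx
          rw [← closure_Ico (zero_ne_one (α := ℝ))] at hx
          refine (isClosed_le (f := fun x => |unitExtend p y - unitExtend p x|)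
            (g := fun x => L * |y - x|) ?_ ?_).closure_subset_iff.2 (fun x hx => hcl x hx y hy) hx
          · exact (continuous_const.sub (continuous_unitExtend p)).abs
          · fun_prop
        intro x y
        have := hcl' y y.2 x x.2
        rwa [unitExtend_coe, unitExtend_coe] at this
      · rw [← cellMap_apply_one hx]
        exact abs_le.1 (abs_slopeSin_le_one _)
    · rintro ⟨⟨μ, x⟩, ⟨hu, hz⟩, rfl⟩
      exact ⟨abs_le.2 hu.1, x, hz⟩
  rw [himg]
  exact ((hK.inter_right hZ).image continuous_fst).isClosed

/-- The set of solvable `μ` is clopen in the connected line and contains `0`. -/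
theorem exists_cellMap_eq_zero {ρ : ℝ → ℝ} {m M : ℝ} (hρ : IsBoundedRate ρ m M) (μ : ℝ) :
    ∃ x, cellMap hρ.primitive (μ, x) = 0 := by
  have hclopen : IsClopen {μ | ∃ x, cellMap hρ.primitive (μ, x) = 0} := by
    refine ⟨isOpen_compl_iff.1 (isOpen_iff_mem_nhds.2 fun μ hμ => ?_),
      isOpen_iff_mem_nhds.2 ?_⟩
    · have h1 : {ν | |ν| ≤ |μ| + 1 ∧ ∃ x, cellMap hρ.primitive (ν, x) = 0}ᶜ ∈ 𝓝 μ :=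
        (isClosed_setOf_solvable hρ (|μ| + 1)).isOpen_compl.mem_nhds fun h => hμ h.2
      have h2 : {ν : ℝ | |ν| < |μ| + 1} ∈ 𝓝 μ :=
        (isOpen_lt continuous_abs continuous_const).mem_nhds (by simp)
      filter_upwards [h1, h2] with ν h3 h4 h5
      exact h3 ⟨le_of_lt h4, h5⟩
    · rintro μ ⟨x, hx⟩
      obtain ⟨φ, -, hφ⟩ := exists_contDiffAt_cellMap_eq_zero hx
      filter_upwards [hφ] with ν hν
      exact ⟨φ ν, hν⟩
  have huniv := hclopen.eq_univ ⟨0, _, cellMap_zero⟩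
  exact huniv.ge (mem_univ μ)

/-- The solution of the cell problem as a function of the inverse `μ` of the curvature regime. -/
noncomputable def cellSolution {ρ : ℝ → ℝ} {m M : ℝ} (hρ : IsBoundedRate ρ m M) (μ : ℝ) :
    CellSpace := (exists_cellMap_eq_zero hρ μ).choose

theorem cellMap_cellSolution {ρ : ℝ → ℝ} {m M : ℝ} (hρ : IsBoundedRate ρ m M) (μ : ℝ) :
    cellMap hρ.primitive (μ, cellSolution hρ μ) = 0 := (exists_cellMap_eq_zero hρ μ).choose_spec

theorem contDiff_cellSolution {ρ : ℝ → ℝ} {m M : ℝ} (hρ : IsBoundedRate ρ m M) :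
    ContDiff ℝ ∞ (cellSolution hρ) := by
  rw [contDiff_iff_contDiffAt]
  intro μ
  obtain ⟨φ, hφ, hφ'⟩ := exists_contDiffAt_cellMap_eq_zero (cellMap_cellSolution hρ μ)
  refine hφ.congr_of_eventuallyEq ?_
  filter_upwards [hφ'] with ν hν
  exact cellMap_solution_unique hρ.primitive_zero (cellMap_cellSolution hρ ν) hν

/-! ### Weak derivatives and primitives -/

theorem LipschitzWith.integral_deriv_eq_sub {f : ℝ → ℝ} {K : NNReal} (hf : LipschitzWith K f)
    (a b : ℝ) : ∫ x in a..b, deriv f x = f b - f a :=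
  (hf.lipschitzOnWith (s := uIcc a b)).absolutelyContinuousOnInterval.integral_deriv_eq_sub

theorem MeasureTheory.MemLp.intervalIntegrable_of_top {v : ℝ → ℝ} (hv : MemLp v ⊤ volume)
    (a b : ℝ) : IntervalIntegrable v volume a b :=
  ((hv.locallyIntegrable le_top).integrableOn_isCompact isCompact_uIcc).intervalIntegrable

theorem exists_lipschitzWith_primitive {v : ℝ → ℝ} (hv : MemLp v ⊤ volume) (C : ℝ) :
    ∃ K, LipschitzWith K fun x => C + ∫ t in (0 : ℝ)..x, v t := by
  refine ⟨Real.toNNReal (lpNorm v ⊤ volume), LipschitzWith.of_dist_le_mul fun x y => ?_⟩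
  rw [dist_add_left, dist_eq_norm, intervalIntegral.integral_interval_sub_left
    (hv.intervalIntegrable_of_top _ _) (hv.intervalIntegrable_of_top _ _),
    Real.coe_toNNReal _ lpNorm_nonneg, Real.dist_eq]
  refine intervalIntegral.norm_integral_le_of_norm_le_const_ae ?_
  filter_upwards [ae_le_lpNorm_exponent_top hv] with t ht _ using ht

theorem ae_hasDerivAt_primitive {v : ℝ → ℝ} (hv : MemLp v ⊤ volume) (C : ℝ) :
    ∀ᵐ x, HasDerivAt (fun x => C + ∫ t in (0 : ℝ)..x, v t) (v x) x := by
  filter_upwards [_root_.LocallyIntegrable.ae_hasDerivAt_integral (hv.locallyIntegrable le_top)] with x hx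
  exact (hx 0).const_add C

/-- Integration by parts for a Lipschitz function against a test function. -/
theorem LipschitzWith.integral_mul_deriv_test {U v φ : ℝ → ℝ} {K : NNReal}
    (hU : LipschitzWith K U) (hv : ∀ᵐ x, HasDerivAt U (v x) x) (hφ : ContDiff ℝ ∞ φ)
    (hc : HasCompactSupport φ) : ∫ z, U z * deriv φ z = -∫ z, v z * φ z := by
  obtain ⟨R, hR, hφR⟩ := hc.exists_pos_le_norm
  have hoff : ∀ x, x ∉ Ioc (-R) R → φ x = 0 := fun x hx => by
    refine hφR x (le_of_not_gt fun h => hx ?_)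
    rw [Real.norm_eq_abs, abs_lt] at h
    exact ⟨h.1, h.2.le⟩
  obtain ⟨R', hR', hφR'⟩ := hc.deriv.exists_pos_le_norm
  have hN : ∀ f g : ℝ → ℝ, (∀ x, max R R' ≤ ‖x‖ → g x = 0) →
      Function.support (fun x => f x * g x) ⊆ Ioc (-(max R R')) (max R R') := by
    intro f g hg x hx
    have : g x ≠ 0 := right_ne_zero_of_mul hx
    have := lt_of_not_ge (mt (hg x) this)
    rw [Real.norm_eq_abs, abs_lt] at this
    exact ⟨this.1, this.2.le⟩
  rw [← intervalIntegral.integral_eq_integral_of_support_subset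
      (hN U (deriv φ) fun x hx => hφR' x ((le_max_right _ _).trans hx)),
    ← intervalIntegral.integral_eq_integral_of_support_subset
      (hN v φ fun x hx => hφR x ((le_max_left _ _).trans hx))]
  have hp : max R R' ≤ ‖max R R'‖ := le_abs_self _
  have hp' : max R R' ≤ ‖-max R R'‖ := by rw [norm_neg]; exact hp
  rw [AbsolutelyContinuousOnInterval.integral_mul_deriv_eq_deriv_mul
    hU.lipschitzOnWith.absolutelyContinuousOnInterval
    (hφ.of_le (by simp)).contDiffOn.absolutelyContinuousOnInterval,
    hφR _ ((le_max_left _ _).trans hp), hφR _ ((le_max_left _ _).trans hp'), mul_zero, mul_zero,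
    sub_zero, zero_sub]
  congr 1
  refine intervalIntegral.integral_congr_ae ?_
  filter_upwards [hv] with x hx _
  rw [hx.deriv]

theorem exists_test_primitive {χ : ℝ → ℝ} (hχ : ContDiff ℝ ∞ χ) (hc : HasCompactSupport χ)
    (h0 : ∫ x, χ x = 0) :
    ∃ Φ : ℝ → ℝ, ContDiff ℝ ∞ Φ ∧ HasCompactSupport Φ ∧ deriv Φ = χ := by
  obtain ⟨R, hR, hχR⟩ := hc.exists_pos_le_norm
  have hii := fun a b => hχ.continuous.intervalIntegrable (μ := volume) a b
  have hd : ∀ x, HasDerivAt (fun x => ∫ t in (-R)..x, χ t) (χ x) x := fun x =>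
    intervalIntegral.integral_hasDerivAt_right (hii _ _)
      (hχ.continuous.stronglyMeasurableAtFilter _ _) hχ.continuous.continuousAt
  have hderiv : deriv (fun x => ∫ t in (-R)..x, χ t) = χ := funext fun x => (hd x).deriv
  have hsupp : Function.support χ ⊆ Ioc (-R) R := fun x hx => by
    have := lt_of_not_ge (mt (hχR x) hx)
    rw [Real.norm_eq_abs, abs_lt] at this
    exact ⟨this.1, this.2.le⟩
  refine ⟨_, contDiff_infty_iff_deriv.2 ⟨fun x => (hd x).differentiableAt, by rwa [hderiv]⟩,
    HasCompactSupport.intro (isCompact_Icc (a := -R) (b := R)) fun x hx => ?_, hderiv⟩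
  have hzero : ∀ a b : ℝ, (∀ t ∈ uIcc a b, R ≤ |t|) → ∫ t in a..b, χ t = 0 := fun a b h =>
    intervalIntegral.integral_zero_ae (Eventually.of_forall fun t ht =>
      hχR t (h t (uIoc_subset_uIcc ht)))
  rcases lt_or_ge x (-R) with h | h
  · refine hzero _ _ fun t ht => ?_
    rw [uIcc_of_ge h.le] at ht
    exact le_abs.2 (Or.inr (by linarith [ht.2]))
  · have h' : R < x := lt_of_not_ge fun h' => hx ⟨h, h'⟩
    rw [← intervalIntegral.integral_add_adjacent_intervals (hii (-R) R) (hii R x),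
      intervalIntegral.integral_eq_integral_of_support_subset hsupp, h0, zero_add]
    refine hzero _ _ fun t ht => ?_
    rw [uIcc_of_le h'.le] at ht
    exact le_abs.2 (Or.inl ht.1)

/-- **du Bois-Reymond**: a function with zero weak derivative is constant. -/
theorem ae_eq_const_of_integral_mul_deriv_eq_zero {f : ℝ → ℝ} (hf : LocallyIntegrable f volume)
    (h : ∀ φ : ℝ → ℝ, ContDiff ℝ ∞ φ → HasCompactSupport φ → ∫ z, f z * deriv φ z = 0) :
    ∃ C, ∀ᵐ x, f x = C := by
  let b : ContDiffBump (0 : ℝ) := default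
  set η : ℝ → ℝ := b.normed volume
  have hη : ContDiff ℝ ∞ η := b.contDiff_normed
  have hηc : HasCompactSupport η := b.hasCompactSupport_normed
  have hη1 : ∫ x, η x = 1 := b.integral_normed
  refine ⟨∫ x, f x * η x, ae_eq_of_integral_contDiff_smul_eq hf
    (locallyIntegrable_const _) fun ψ hψ hψc => ?_⟩
  set I := ∫ x, ψ x with hI
  have hint : ∀ g : ℝ → ℝ, ContDiff ℝ ∞ g → HasCompactSupport g → Integrable g :=
    fun g hg hgc => hg.continuous.integrable_of_hasCompactSupport hgc
  have hfint : ∀ g : ℝ → ℝ, ContDiff ℝ ∞ g → HasCompactSupport g →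
      Integrable fun x => f x * g x :=
    fun g hg hgc => hf.integrable_smul_right_of_hasCompactSupport hg.continuous hgc
  have hηI : ContDiff ℝ ∞ fun x => I * η x := contDiff_const.mul hη
  have hηIc : HasCompactSupport fun x => I * η x := hηc.mul_left
  -- Subtracting `I * η` removes the mean of `ψ`, so the difference is the derivative of a test
  -- function.
  obtain ⟨Φ, h1, h2, h3⟩ := exists_test_primitive (hψ.sub hηI) (hψc.sub hηIc) (by
    rw [integral_sub (hint _ hψ hψc) (hint _ hηI hηIc), integral_const_mul, hη1, mul_one, sub_self])
  have := h Φ h1 h2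
  rw [h3] at this
  simp only [mul_sub] at this
  rw [integral_sub (hfint _ hψ hψc) (hfint _ hηI hηIc), sub_eq_zero] at this
  simp only [smul_eq_mul]
  rw [integral_mul_const, ← hI, ← integral_const_mul]
  simp only [mul_comm (ψ _), this]
  exact integral_congr_ae (Eventually.of_forall fun x => by ring)

/-- The difference between `u` and the primitive of `v` has zero weak derivative. -/
theorem IsWeakDeriv.exists_primitive {u v : LInf} (h : IsWeakDeriv u v) :
    ∃ C, ∀ᵐ x, u x = C + ∫ t in (0 : ℝ)..x, v t := by
  have hv := Lp.memLp v
  obtain ⟨K, hK⟩ := exists_lipschitzWith_primitive hv 0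
  have hU := hK.continuous.locallyIntegrable (μ := volume)
  have hu : LocallyIntegrable u volume := (Lp.memLp u).locallyIntegrable le_top
  obtain ⟨C, hC⟩ := ae_eq_const_of_integral_mul_deriv_eq_zero (hu.sub hU) fun φ hφ hc => by
    have hd := hφ.continuous_deriv (by simp)
    have h1 := hK.integral_mul_deriv_test (ae_hasDerivAt_primitive hv 0) hφ hc
    have h2 := hU.integrable_smul_right_of_hasCompactSupport hd hc.deriv
    simp only [smul_eq_mul] at h2
    simp only [Pi.sub_apply, sub_mul]
    rw [integral_sub (u.integrable_mul hd hc.deriv) h2, h1, h φ hφ hc, sub_self]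
  refine ⟨C, ?_⟩
  filter_upwards [hC] with x hx
  rw [Pi.sub_apply, zero_add] at hx
  linarith

theorem IsWeakDeriv.of_lipschitz {u v : LInf} {U V : ℝ → ℝ} {K : NNReal} (hU : LipschitzWith K U)
    (hUV : ∀ᵐ x, HasDerivAt U (V x) x) (hu : u =ᵐ[volume] U) (hv : v =ᵐ[volume] V) :
    IsWeakDeriv u v := by
  intro φ hφ hc
  have e1 : ∫ z, u z * deriv φ z = ∫ z, U z * deriv φ z :=
    integral_congr_ae (by filter_upwards [hu] with x hx; rw [hx])
  have e2 : ∫ z, v z * φ z = ∫ z, V z * φ z :=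
    integral_congr_ae (by filter_upwards [hv] with x hx; rw [hx])
  rw [e1, e2]
  exact hU.integral_mul_deriv_test hUV hφ hc

/-! ### From correctors to periodic slopes; uniqueness -/

theorem lipschitzWith_slopeSin : LipschitzWith 1 slopeSin := by
  refine lipschitzWith_of_nnnorm_deriv_le (contDiff_slopeSin.differentiable (by simp)) fun p => ?_
  rw [(hasDerivAt_slopeSin p).deriv, ← NNReal.coe_le_coe, coe_nnnorm, NNReal.coe_one,
    Real.norm_of_nonneg (pow_pos (slopeCos_pos p) 3).le]
  exact pow_le_one₀ (slopeCos_pos p).le (slopeCos_le_one p)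

/-- The cell equation in terms of the cosine of the slope angle. -/
theorem cell_equation_iff {ρ p k c lam : ℝ} (hlam : 0 < lam) :
    -c + ρ * Real.sqrt (1 + p ^ 2) = lam * (k / (1 + p ^ 2)) ↔
      slopeCos p ^ 3 * k = lam⁻¹ * (ρ - c * slopeCos p) := by
  have hs : 0 < Real.sqrt (1 + p ^ 2) := by positivity
  have h1 : Real.sqrt (1 + p ^ 2) ^ 2 = 1 + p ^ 2 := Real.sq_sqrt (by positivity)
  rw [slopeCos, ← h1]
  set s := Real.sqrt (1 + p ^ 2)
  rw [Real.sqrt_sq hs.le]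
  field_simp
  constructor <;> intro h <;> linear_combination -h

/-- The continuous representatives of `w` and `w_z` are primitives. Continuity turns almost
everywhere periodicity of `w` into periodicity, hence that of `P`; the sine of the Lipschitz `P` is
the integral of its derivative. -/
theorem IsCorrector.exists_isCellSlope {ρ : ℝ → ℝ} {lam c : ℝ} (hlam : 0 < lam) {w : W2InfPer}
    (h : IsCorrector ρ lam c w) :
    ∃ P, IsCellSlope ρ lam⁻¹ c P ∧ (W2InfPer.dz w : ℝ → ℝ) =ᵐ[volume] P ∧
      ∃ C, ∀ᵐ x, W2InfPer.toLInf w x = C + ∫ t in (0 : ℝ)..x, P t := by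
  obtain ⟨h1, h2, hper⟩ := w.2
  change IsWeakDeriv (W2InfPer.toLInf w) (W2InfPer.dz w) at h1
  change IsWeakDeriv (W2InfPer.dz w) (W2InfPer.dzz w) at h2
  change ∀ᵐ z, W2InfPer.toLInf w (z + 1) = W2InfPer.toLInf w z at hper
  obtain ⟨C₁, hC₁⟩ := h2.exists_primitive
  have hk := Lp.memLp (W2InfPer.dzz w)
  obtain ⟨K, hK⟩ := exists_lipschitzWith_primitive hk C₁
  have hKd := ae_hasDerivAt_primitive hk C₁
  set P : ℝ → ℝ := fun x => C₁ + ∫ t in (0 : ℝ)..x, W2InfPer.dzz w t with hP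
  have hPint := fun a b => hK.continuous.intervalIntegrable (μ := volume) a b
  obtain ⟨C₀, hC₀⟩ := h1.exists_primitive
  have hC₀' : ∀ᵐ x, W2InfPer.toLInf w x = C₀ + ∫ t in (0 : ℝ)..x, P t := by
    filter_upwards [hC₀] with x hx
    rw [hx, intervalIntegral.integral_congr_ae (hC₁.mono fun t ht _ => ht)]
  have hWd : ∀ x, HasDerivAt (fun x => C₀ + ∫ t in (0 : ℝ)..x, P t) (P x) x := fun x =>
    (intervalIntegral.integral_hasDerivAt_right (hPint 0 x)
      (hK.continuous.stronglyMeasurableAtFilter _ _) hK.continuous.continuousAt).const_add C₀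
  have hWc : Continuous fun x => C₀ + ∫ t in (0 : ℝ)..x, P t :=
    continuous_iff_continuousAt.2 fun x => (hWd x).continuousAt
  have hWper : (fun x => C₀ + ∫ t in (0 : ℝ)..(x + 1), P t) =
      fun x => C₀ + ∫ t in (0 : ℝ)..x, P t := by
    refine (Continuous.ae_eq_iff_eq volume (hWc.comp (continuous_add_const 1)) hWc).1 ?_
    filter_upwards [hC₀', hper,
      (measurePreserving_add_right volume (1 : ℝ)).quasiMeasurePreserving.ae hC₀'] with x a1 a2 a3
    exact a3.symm.trans (a2.trans a1)
  have hPper : Function.Periodic P 1 := fun x => by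
    have := (hWd (x + 1)).comp_add_const x 1
    rw [hWper] at this
    exact this.unique (hWd x)
  refine ⟨P, ⟨hK.continuous, hPper, ?_, fun x y => ?_⟩, hC₁, C₀, hC₀'⟩
  · have := congrFun hWper 0
    simpa using this
  · have hlip := lipschitzWith_slopeSin.comp hK
    rw [← Function.comp_apply (f := slopeSin) (x := y), ← Function.comp_apply (f := slopeSin) (x := x),
      ← hlip.integral_deriv_eq_sub]
    refine intervalIntegral.integral_congr_ae ?_
    filter_upwards [hKd, hC₁, h.1] with t a1 a2 a3 _
    rw [a2] at a3
    rw [((hasDerivAt_slopeSin (P t)).comp t a1).deriv]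
    exact (cell_equation_iff hlam).1 a3

theorem IsCorrector.unique {ρ : ℝ → ℝ} {m M lam c c' : ℝ} (hρ : IsBoundedRate ρ m M)
    (hlam : 0 < lam) {w w' : W2InfPer} (h : IsCorrector ρ lam c w) (h' : IsCorrector ρ lam c' w') :
    c = c' ∧ w = w' := by
  obtain ⟨P, hP, hPw, C, hC⟩ := h.exists_isCellSlope hlam
  obtain ⟨P', hP', hPw', C', hC'⟩ := h'.exists_isCellSlope hlam
  obtain ⟨rfl, rfl⟩ := hP.unique hρ (inv_ne_zero hlam.ne') hP'
  -- The zero-mean condition fixes the constant of integration.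
  have hCC : C = C' := by
    have hint : IntervalIntegrable (fun x => ∫ t in (0 : ℝ)..x, P t) volume 0 1 :=
      (intervalIntegral.continuous_primitive
        (fun a b => hP.continuous.intervalIntegrable a b) 0).intervalIntegrable _ _
    have key : ∀ {u : W2InfPer} {C : ℝ}, periodMean (W2InfPer.toLInf u) = 0 →
        (∀ᵐ x, W2InfPer.toLInf u x = C + ∫ t in (0 : ℝ)..x, P t) →
        C + ∫ x in (0 : ℝ)..1, ∫ t in (0 : ℝ)..x, P t = 0 := by
      intro u C h0 hu
      rw [periodMean, intervalIntegral.integral_congr_ae (hu.mono fun x hx _ => hx),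
        intervalIntegral.integral_add intervalIntegrable_const hint] at h0
      simpa using h0
    have a1 := key h.2 hC
    have a2 := key h'.2 hC'
    linarith
  subst hCC
  refine ⟨rfl, Subtype.ext (Prod.ext (Lp.ext ?_) (Prod.ext (Lp.ext ?_) (Lp.ext ?_)))⟩
  · filter_upwards [hC, hC'] with x a1 a2
    exact a1.trans a2.symm
  · exact hPw.trans hPw'.symm
  · filter_upwards [hPw, hPw', h.1, h'.1] with x a1 a2 a3 a4
    rw [a1] at a3
    rw [a2] at a4
    have := ((cell_equation_iff hlam).1 a3).trans ((cell_equation_iff hlam).1 a4).symm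
    exact mul_left_cancel₀ (pow_pos (slopeCos_pos _) 3).ne' this

/-! ### Periodic double integration into `W2InfPer` -/

/-- A measurable `1`-periodic function bounded almost everywhere by `B`. -/
structure IsPeriodicBounded (v : ℝ → ℝ) (B : ℝ) : Prop where
  memLp : MemLp v ⊤ volume
  periodic : Function.Periodic v 1
  nonneg : 0 ≤ B
  bound : ∀ᵐ x, ‖v x‖ ≤ B

/-- Subtraction of the mean value over one period. -/
noncomputable def centered (v : ℝ → ℝ) (x : ℝ) : ℝ := v x - ∫ t in (0 : ℝ)..1, v t

/-- The primitive of the centered function that vanishes at `0`. -/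
noncomputable def periodicPrimitive (v : ℝ → ℝ) (x : ℝ) : ℝ := ∫ t in (0 : ℝ)..x, centered v t

namespace IsPeriodicBounded

variable {v : ℝ → ℝ} {B : ℝ}

theorem intervalIntegrable (h : IsPeriodicBounded v B) (a b : ℝ) :
    IntervalIntegrable v volume a b := h.memLp.intervalIntegrable_of_top a b

theorem centered (h : IsPeriodicBounded v B) : IsPeriodicBounded (centered v) (2 * B) := by
  refine ⟨?_, fun x => by simp only [_root_.centered, h.periodic x],
    mul_nonneg zero_le_two h.nonneg, ?_⟩
  · exact h.memLp.sub (memLp_top_const _)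
  · have hI : ‖∫ t in (0 : ℝ)..1, v t‖ ≤ B := by
      have := intervalIntegral.norm_integral_le_of_norm_le_const_ae (a := 0) (b := 1) (f := v)
        (C := B) (h.bound.mono fun x hx _ => hx)
      simpa using this
    filter_upwards [h.bound] with x hx
    calc ‖v x - ∫ t in (0 : ℝ)..1, v t‖ ≤ ‖v x‖ + ‖∫ t in (0 : ℝ)..1, v t‖ := norm_sub_le _ _
      _ ≤ 2 * B := by linarith

theorem integral_centered (h : IsPeriodicBounded v B) :
    ∫ t in (0 : ℝ)..1, _root_.centered v t = 0 := by
  simp only [_root_.centered]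
  rw [intervalIntegral.integral_sub (h.intervalIntegrable 0 1) intervalIntegrable_const]
  simp

theorem exists_lipschitzWith (h : IsPeriodicBounded v B) :
    ∃ K, LipschitzWith K (periodicPrimitive v) := by
  have := exists_lipschitzWith_primitive h.centered.memLp 0
  simp only [zero_add] at this
  exact this

theorem ae_hasDerivAt (h : IsPeriodicBounded v B) :
    ∀ᵐ x, HasDerivAt (periodicPrimitive v) (_root_.centered v x) x := by
  have := ae_hasDerivAt_primitive h.centered.memLp 0
  simp only [zero_add] at this
  exact this

theorem periodicPrimitive (h : IsPeriodicBounded v B) :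
    IsPeriodicBounded (periodicPrimitive v) (2 * B) := by
  have hii := h.centered.intervalIntegrable
  have hper : Function.Periodic (_root_.periodicPrimitive v) 1 := fun x => by
    simp only [_root_.periodicPrimitive]
    rw [← intervalIntegral.integral_add_adjacent_intervals (hii 0 x) (hii x (x + 1)),
      h.centered.periodic.intervalIntegral_add_eq x 0, zero_add, h.integral_centered, add_zero]
  have hbd : ∀ x, ‖_root_.periodicPrimitive v x‖ ≤ 2 * B := by
    intro x
    rw [← hper.eq_fract x]
    refine (intervalIntegral.norm_integral_le_of_norm_le_const_ae
      (h.centered.bound.mono fun x hx _ => hx)).trans ?_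
    rw [sub_zero, abs_of_nonneg (Int.fract_nonneg x)]
    exact mul_le_of_le_one_right h.centered.nonneg (Int.fract_lt_one x).le
  obtain ⟨K, hK⟩ := h.exists_lipschitzWith
  exact ⟨memLp_top_of_bound hK.continuous.aestronglyMeasurable _ (Eventually.of_forall hbd),
    hper, h.centered.nonneg, Eventually.of_forall hbd⟩

/-- The periodic slope with derivative `centered v`. -/
theorem slope (h : IsPeriodicBounded v B) :
    IsPeriodicBounded (_root_.centered (_root_.periodicPrimitive v)) (2 * (2 * B)) :=
  h.periodicPrimitive.centered

/-- Each of the four centerings doubles the bound, and integrating over at most one period does not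
increase it. -/
theorem height (h : IsPeriodicBounded v B) :
    IsPeriodicBounded (_root_.centered (_root_.periodicPrimitive
      (_root_.centered (_root_.periodicPrimitive v)))) (2 * (2 * (2 * (2 * B)))) :=
  h.slope.slope

end IsPeriodicBounded

theorem centered_eq_self {v : ℝ → ℝ} (h : ∫ t in (0 : ℝ)..1, v t = 0) : centered v = v := by
  funext x; rw [centered, h, sub_zero]

theorem centered_add {v v' : ℝ → ℝ} {B B' : ℝ} (h : IsPeriodicBounded v B)
    (h' : IsPeriodicBounded v' B') : centered (v + v') = centered v + centered v' := by
  funext x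
  simp only [centered, Pi.add_apply]
  rw [intervalIntegral.integral_add (h.intervalIntegrable 0 1) (h'.intervalIntegrable 0 1)]
  ring

theorem centered_smul (r : ℝ) (v : ℝ → ℝ) : centered (r • v) = r • centered v := by
  funext x
  simp only [centered, Pi.smul_apply, smul_eq_mul, intervalIntegral.integral_const_mul]
  ring

theorem periodicPrimitive_add {v v' : ℝ → ℝ} {B B' : ℝ} (h : IsPeriodicBounded v B)
    (h' : IsPeriodicBounded v' B') :
    periodicPrimitive (v + v') = periodicPrimitive v + periodicPrimitive v' := by
  funext x
  simp only [periodicPrimitive, Pi.add_apply, centered_add h h']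
  exact intervalIntegral.integral_add (h.centered.intervalIntegrable 0 x)
    (h'.centered.intervalIntegrable 0 x)

theorem periodicPrimitive_smul (r : ℝ) (v : ℝ → ℝ) :
    periodicPrimitive (r • v) = r • periodicPrimitive v := by
  funext x
  simp only [periodicPrimitive, centered_smul, Pi.smul_apply, smul_eq_mul,
    intervalIntegral.integral_const_mul]

theorem norm_toLp_top_le {v : ℝ → ℝ} {B : ℝ} (h : IsPeriodicBounded v B) :
    ‖h.memLp.toLp v‖ ≤ B := by
  rw [Lp.norm_toLp]
  refine ENNReal.toReal_le_of_le_ofReal h.nonneg ?_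
  rw [eLpNorm_exponent_top]
  exact eLpNormEssSup_le_of_ae_bound h.bound

theorem toLp_eq_add {f g k : ℝ → ℝ} {p : ENNReal} (hf : MemLp f p volume) (hg : MemLp g p volume)
    (hk : MemLp k p volume) (h : f = g + k) : hf.toLp f = hg.toLp g + hk.toLp k := by
  subst h; rfl

theorem toLp_eq_smul {f g : ℝ → ℝ} {p : ENNReal} (hf : MemLp f p volume) (hg : MemLp g p volume)
    (r : ℝ) (h : f = r • g) : hf.toLp f = r • hg.toLp g := by
  subst h; rfl

/-- The zero-mean element of `W^{2,∞}_per` whose second derivative is `centered v`. -/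
noncomputable def doublePrimitive {v : ℝ → ℝ} {B : ℝ} (h : IsPeriodicBounded v B) : W2InfPer :=
  ⟨(h.height.memLp.toLp _, h.slope.memLp.toLp _, h.centered.memLp.toLp _), by
    have hs : centered (centered (periodicPrimitive v)) = centered (periodicPrimitive v) :=
      centered_eq_self h.periodicPrimitive.integral_centered
    refine ⟨?_, ?_, ?_⟩
    · obtain ⟨K, hK⟩ := h.slope.exists_lipschitzWith
      refine IsWeakDeriv.of_lipschitz (hK.sub (LipschitzWith.const _)) ?_
        (MemLp.coeFn_toLp h.height.memLp) (MemLp.coeFn_toLp h.slope.memLp)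
      filter_upwards [h.slope.ae_hasDerivAt] with x hx
      rw [hs] at hx
      exact hx.sub_const _
    · obtain ⟨K, hK⟩ := h.exists_lipschitzWith
      refine IsWeakDeriv.of_lipschitz (hK.sub (LipschitzWith.const _)) ?_
        (MemLp.coeFn_toLp h.slope.memLp) (MemLp.coeFn_toLp h.centered.memLp)
      filter_upwards [h.ae_hasDerivAt] with x hx using hx.sub_const _
    · filter_upwards [MemLp.coeFn_toLp h.height.memLp,
        (measurePreserving_add_right volume (1 : ℝ)).quasiMeasurePreserving.ae
          (MemLp.coeFn_toLp h.height.memLp)] with x h1 h2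
      exact h2.trans ((h.height.periodic x).trans h1.symm)⟩

theorem norm_doublePrimitive_le {v : ℝ → ℝ} {B : ℝ} (h : IsPeriodicBounded v B) :
    ‖doublePrimitive h‖ ≤ 16 * B := by
  have hB := h.nonneg
  have h0 := norm_toLp_top_le h.height
  have h1 := norm_toLp_top_le h.slope
  have h2 := norm_toLp_top_le h.centered
  exact max_le (h0.trans (by linarith)) (max_le (h1.trans (by linarith)) (h2.trans (by linarith)))

theorem doublePrimitive_add {v v' u : ℝ → ℝ} {B B' C : ℝ} (h : IsPeriodicBounded v B)
    (h' : IsPeriodicBounded v' B') (hu : IsPeriodicBounded u C) (huv : u = v + v') :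
    doublePrimitive hu = doublePrimitive h + doublePrimitive h' := by
  subst huv
  refine Subtype.ext (Prod.ext ?_ (Prod.ext ?_ ?_))
  · refine toLp_eq_add hu.height.memLp h.height.memLp h'.height.memLp ?_
    rw [periodicPrimitive_add h h', centered_add h.periodicPrimitive h'.periodicPrimitive,
      periodicPrimitive_add h.slope h'.slope,
      centered_add h.slope.periodicPrimitive h'.slope.periodicPrimitive]
  · refine toLp_eq_add hu.slope.memLp h.slope.memLp h'.slope.memLp ?_
    rw [periodicPrimitive_add h h', centered_add h.periodicPrimitive h'.periodicPrimitive]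
  · exact toLp_eq_add hu.centered.memLp h.centered.memLp h'.centered.memLp (centered_add h h')

theorem doublePrimitive_smul {v u : ℝ → ℝ} {B C : ℝ} (h : IsPeriodicBounded v B)
    (hu : IsPeriodicBounded u C) (r : ℝ) (huv : u = r • v) :
    doublePrimitive hu = r • doublePrimitive h := by
  subst huv
  refine Subtype.ext (Prod.ext ?_ (Prod.ext ?_ ?_))
  · refine toLp_eq_smul hu.height.memLp h.height.memLp r ?_
    rw [periodicPrimitive_smul, centered_smul, periodicPrimitive_smul, centered_smul]
  · refine toLp_eq_smul hu.slope.memLp h.slope.memLp r ?_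
    rw [periodicPrimitive_smul, centered_smul]
  · exact toLp_eq_smul hu.centered.memLp h.centered.memLp r (centered_smul r v)

/-- The periodic function equal to `ρ a + b` on `[0, 1)`. -/
noncomputable def rateCombination (ρ : ℝ → ℝ) (u : C(unitInterval, ℝ) × C(unitInterval, ℝ))
    (x : ℝ) : ℝ :=
  ρ x * unitExtend u.1 (Int.fract x) + unitExtend u.2 (Int.fract x)

theorem isPeriodicBounded_rateCombination {ρ : ℝ → ℝ} {m M : ℝ} (hρ : IsBoundedRate ρ m M)
    (u : C(unitInterval, ℝ) × C(unitInterval, ℝ)) :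
    IsPeriodicBounded (rateCombination ρ u) (M * ‖u.1‖ + ‖u.2‖) := by
  have hm : ∀ a : C(unitInterval, ℝ), AEMeasurable (fun x => unitExtend a (Int.fract x)) volume :=
    fun a => ((continuous_unitExtend a).measurable.comp measurable_fract).aemeasurable
  have hbd : ∀ᵐ x, ‖rateCombination ρ u x‖ ≤ M * ‖u.1‖ + ‖u.2‖ := by
    filter_upwards [hρ.norm_le] with x hx
    refine (norm_add_le _ _).trans (add_le_add ?_ (norm_unitExtend_le _ _))
    rw [norm_mul]
    exact mul_le_mul hx (norm_unitExtend_le _ _) (norm_nonneg _) hρ.upper_pos.le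
  refine ⟨memLp_top_of_bound
    ((hρ.aemeasurable.mul (hm u.1)).add (hm u.2)).aestronglyMeasurable _ hbd, fun x => ?_, ?_, hbd⟩
  · simp only [rateCombination, hρ.periodic x, Int.fract_add_one]
  · have := hρ.upper_pos
    positivity

/-- The bounded operator sending `(a, b)` to the zero-mean element of `W^{2,∞}_per` whose second
derivative is the centered `ρ a + b`. -/
noncomputable def heightOperator {ρ : ℝ → ℝ} {m M : ℝ} (hρ : IsBoundedRate ρ m M) :
    C(unitInterval, ℝ) × C(unitInterval, ℝ) →L[ℝ] W2InfPer :=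
  LinearMap.mkContinuous
    { toFun := fun u => doublePrimitive (isPeriodicBounded_rateCombination hρ u)
      map_add' := fun u u' => doublePrimitive_add _ _ _ (by
        funext x
        simp only [rateCombination, Pi.add_apply, unitExtend, IccExtend, Function.comp,
          Prod.fst_add, Prod.snd_add, ContinuousMap.add_apply]
        ring)
      map_smul' := fun r u => doublePrimitive_smul _ _ r (by
        funext x
        simp only [rateCombination, Pi.smul_apply, unitExtend, IccExtend, Function.comp,
          Prod.smul_fst, Prod.smul_snd, ContinuousMap.smul_apply, smul_eq_mul]
        ring) } (16 * (M + 1)) (fun u => by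
    refine (norm_doublePrimitive_le (isPeriodicBounded_rateCombination hρ u)).trans ?_
    have h1 := norm_fst_le u
    have h2 := norm_snd_le u
    have := mul_le_mul_of_nonneg_left h1 hρ.upper_pos.le
    linarith)

theorem heightOperator_apply {ρ : ℝ → ℝ} {m M : ℝ} (hρ : IsBoundedRate ρ m M)
    (u : C(unitInterval, ℝ) × C(unitInterval, ℝ)) :
    heightOperator hρ u = doublePrimitive (isPeriodicBounded_rateCombination hρ u) := rfl

/-! ### The corrector and its dependence on the curvature regime -/

/-- The derivative of `sin P` is computed twice almost everywhere: by the chain rule for the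
Lipschitz `P`, and by Lebesgue differentiation of the integral equation. -/
theorem IsCellSlope.ae_hasDerivAt {ρ : ℝ → ℝ} {m M μ c Q : ℝ} {P : ℝ → ℝ}
    (h : IsCellSlope ρ μ c P) (hρ : IsBoundedRate ρ m M) (hc : c ∈ Icc m M)
    (hP : ∀ x, |P x| ≤ Q) :
    (∃ K, LipschitzWith K P) ∧ ∀ᵐ x, HasDerivAt P (deriv P x) x ∧
      slopeCos (P x) ^ 3 * deriv P x = μ * (ρ x - c * slopeCos (P x)) := by
  have hL : 0 ≤ |μ| * (2 * M) / slopeCos Q ^ 3 := by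
    have := hρ.upper_pos
    have := slopeCos_pos Q
    positivity
  have hlip : LipschitzWith (Real.toNNReal (|μ| * (2 * M) / slopeCos Q ^ 3)) P :=
    LipschitzWith.of_dist_le_mul fun x y => by
      rw [Real.coe_toNNReal _ hL]
      exact h.abs_sub_le hρ hc hP y x
  have hloc : LocallyIntegrable (fun t => μ * (ρ t - c * slopeCos (P t))) volume := by
    have hcont : Continuous fun t => c * slopeCos (P t) :=
      continuous_const.mul (contDiff_slopeCos.continuous.comp h.continuous)
    exact (hρ.locallyIntegrable.sub hcont.locallyIntegrable).smul μ
  refine ⟨⟨_, hlip⟩, ?_⟩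
  filter_upwards [hlip.ae_differentiableAt_real,
    _root_.LocallyIntegrable.ae_hasDerivAt_integral hloc] with x h1 h2
  refine ⟨h1.hasDerivAt, ?_⟩
  have h3 := (hasDerivAt_slopeSin (P x)).comp x h1.hasDerivAt
  have h4 : HasDerivAt (slopeSin ∘ P) (μ * (ρ x - c * slopeCos (P x))) x := by
    refine ((h2 0).const_add (slopeSin (P 0))).congr_of_eventuallyEq
      (Eventually.of_forall fun y => ?_)
    have := h.sin_sub 0 y
    simp only [Function.comp]
    linarith
  exact h3.unique h4

/-- The coefficients `(a, b)` with `w_zz = ρ a + b` for the corrector `w` of curvature regime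
`μ⁻¹`. -/
noncomputable def curvatureCoeffs {ρ : ℝ → ℝ} {m M : ℝ} (hρ : IsBoundedRate ρ m M) (μ : ℝ) :
    C(unitInterval, ℝ) × C(unitInterval, ℝ) :=
  μ • (superpose (fun p => (1 + p ^ 2) * Real.sqrt (1 + p ^ 2)) (by fun_prop)
      (cellSolution hρ μ).1,
    -(cellSolution hρ μ).2.1 • superpose (fun p => 1 + p ^ 2) (by fun_prop) (cellSolution hρ μ).1)

theorem contDiff_curvatureCoeffs {ρ : ℝ → ℝ} {m M : ℝ} (hρ : IsBoundedRate ρ m M) :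
    ContDiff ℝ ∞ (curvatureCoeffs hρ) := by
  have h1 : ContDiff ℝ ∞ fun p : ℝ => 1 + p ^ 2 := by fun_prop
  have h2 : ContDiff ℝ ∞ fun p : ℝ => (1 + p ^ 2) * Real.sqrt (1 + p ^ 2) :=
    h1.mul (h1.sqrt fun p => by positivity)
  have h3 := contDiff_superpose (K := unitInterval) h1
  have h4 := contDiff_superpose (K := unitInterval) h2
  have h5 := contDiff_cellSolution hρ
  unfold curvatureCoeffs
  fun_prop

/-- The corrector of curvature regime `lam`. -/
noncomputable def corrector {ρ : ℝ → ℝ} {m M : ℝ} (hρ : IsBoundedRate ρ m M) (lam : ℝ) :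
    W2InfPer := heightOperator hρ (curvatureCoeffs hρ lam⁻¹)

/-- The prescribed second derivative `v` equals `P'` almost everywhere, so it already has mean zero.
Centering leaves it unchanged, and the first centered primitive is exactly `P`. -/
theorem isCorrector_corrector {ρ : ℝ → ℝ} {m M lam : ℝ} (hρ : IsBoundedRate ρ m M)
    (hlam : 0 < lam) :
    IsCorrector ρ lam (cellSolution hρ lam⁻¹).2.1 (corrector hρ lam) := by
  set μ := lam⁻¹ with hμ
  rcases hx : cellSolution hρ μ with ⟨p, c, e⟩
  have h0 := cellMap_cellSolution hρ μ
  rw [hx] at h0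
  have hs := isCellSlope_of_cellMap_eq_zero hρ h0
  obtain ⟨hc, hp⟩ := cellMap_solution_bounds hρ h0
  obtain ⟨⟨K, hK⟩, hd⟩ := hs.ae_hasDerivAt hρ hc (Q := M / m) fun x => hp _
  set P : ℝ → ℝ := fun x => unitExtend p (Int.fract x) with hP
  set v := rateCombination ρ (curvatureCoeffs hρ μ) with hv
  have hvB := isPeriodicBounded_rateCombination hρ (curvatureCoeffs hρ μ)
  rw [← hv] at hvB
  have hvx : ∀ x, v x = μ * ((1 + P x ^ 2) * (ρ x * Real.sqrt (1 + P x ^ 2) - c)) := by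
    intro x
    simp only [hv, rateCombination, curvatureCoeffs, hx, unitExtend, IccExtend, Function.comp,
      Prod.smul_fst, Prod.smul_snd, ContinuousMap.smul_apply, superpose_apply, smul_eq_mul, P]
    ring
  have hvcell : ∀ x, slopeCos (P x) ^ 3 * v x = μ * (ρ x - c * slopeCos (P x)) := by
    intro x
    refine (cell_equation_iff hlam).1 ?_
    rw [hvx]
    have : 0 < 1 + P x ^ 2 := by positivity
    rw [hμ]
    field_simp
    ring
  have hdv : deriv P =ᵐ[volume] v := by
    filter_upwards [hd] with x hx
    exact mul_left_cancel₀ (pow_pos (slopeCos_pos _) 3).ne' (hx.2.trans (hvcell x).symm)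
  have hint : ∀ a b, ∫ t in a..b, v t = P b - P a := fun a b => by
    rw [← hK.integral_deriv_eq_sub]
    exact intervalIntegral.integral_congr_ae (hdv.mono fun x hx _ => hx.symm)
  have hcv : centered v = v := centered_eq_self (by
    have := hs.periodic 0
    rw [zero_add] at this
    rw [hint, this, sub_self])
  have hprim : periodicPrimitive v = fun x => P x - P 0 := funext fun x => by
    rw [periodicPrimitive, hcv, hint]
  have hslope : centered (periodicPrimitive v) = P := by
    funext x
    rw [hprim, centered, intervalIntegral.integral_sub (hs.continuous.intervalIntegrable _ _)
      intervalIntegrable_const, hs.integral_eq_zero]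
    simp
  have hcor : corrector hρ lam = doublePrimitive hvB := heightOperator_apply hρ _
  have hdz : (W2InfPer.dz (corrector hρ lam) : ℝ → ℝ) =ᵐ[volume] P := by
    rw [hcor]
    exact (MemLp.coeFn_toLp hvB.slope.memLp).trans (by rw [hslope])
  have hdzz : (W2InfPer.dzz (corrector hρ lam) : ℝ → ℝ) =ᵐ[volume] v := by
    rw [hcor]
    exact (MemLp.coeFn_toLp hvB.centered.memLp).trans (by rw [hcv])
  constructor
  · filter_upwards [hdz, hdzz] with x h1 h2
    rw [h1, h2]
    exact (cell_equation_iff hlam).2 (hvcell x)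
  · have h1 : (W2InfPer.toLInf (corrector hρ lam) : ℝ → ℝ) =ᵐ[volume]
        centered (periodicPrimitive (centered (periodicPrimitive v))) := by
      rw [hcor]
      exact MemLp.coeFn_toLp hvB.height.memLp
    rw [periodMean, intervalIntegral.integral_congr_ae (h1.mono fun x hx _ => hx)]
    exact hvB.slope.periodicPrimitive.integral_centered

theorem corrector_injOn {ρ : ℝ → ℝ} {m M : ℝ} (hρ : IsBoundedRate ρ m M)
    (hne : ¬ ∃ k : ℝ, ∀ᵐ z : ℝ, ρ z = k) : InjOn (corrector hρ) (Ioi 0) := by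
  intro l₁ hl₁ l₂ hl₂ heq
  by_contra hl
  refine hne ?_
  have h₁ := isCorrector_corrector hρ hl₁
  have h₂ := isCorrector_corrector hρ hl₂
  rw [← heq] at h₂
  set c₁ := (cellSolution hρ l₁⁻¹).2.1
  set c₂ := (cellSolution hρ l₂⁻¹).2.1
  set w := corrector hρ l₁
  obtain ⟨P, hP, hPw, -⟩ := h₁.exists_isCellSlope hl₁
  obtain ⟨C, hC⟩ := (w.2.2.1 : IsWeakDeriv (W2InfPer.dz w) (W2InfPer.dzz w)).exists_primitive
  have hk := Lp.memLp (W2InfPer.dzz w)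
  obtain ⟨L, hL⟩ := exists_lipschitzWith_primitive hk C
  have hPC : P = fun x => C + ∫ t in (0 : ℝ)..x, W2InfPer.dzz w t :=
    (Continuous.ae_eq_iff_eq volume hP.continuous hL.continuous).1 (hPw.symm.trans hC)
  -- Subtracting the two equations for the common `w` gives `c₂ - c₁ = (l₁ - l₂) w_zz / (1 + w_z²)`.
  set κ := (c₂ - c₁) / (l₁ - l₂) with hκ
  have hkκ : ∀ᵐ x, W2InfPer.dzz w x = κ * (1 + P x ^ 2) := by
    filter_upwards [h₁.1, h₂.1, hPw] with x a1 a2 a3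
    rw [a3] at a1 a2
    have hpos : 0 < 1 + P x ^ 2 := by positivity
    have hl' : l₁ - l₂ ≠ 0 := sub_ne_zero.2 hl
    have : W2InfPer.dzz w x / (1 + P x ^ 2) = κ := by
      rw [hκ, eq_div_iff hl']
      linarith
    rw [← this]
    field_simp
  have hκ0 : κ = 0 := by
    have h1 : ∫ t in (0 : ℝ)..1, W2InfPer.dzz w t = 0 := by
      have e1 := congrFun hPC 1
      have e0 := congrFun hPC 0
      have := hP.periodic 0
      rw [zero_add] at this
      simp only [intervalIntegral.integral_same] at e0
      linarith
    rw [intervalIntegral.integral_congr_ae (hkκ.mono fun x hx _ => hx),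
      intervalIntegral.integral_const_mul] at h1
    refine (mul_eq_zero.1 h1).resolve_right (ne_of_gt ?_)
    refine intervalIntegral.intervalIntegral_pos_of_pos ?_ (fun x => by positivity) zero_lt_one
    exact (continuous_const.add (hP.continuous.pow 2)).intervalIntegrable _ _
  have hP0 : ∀ x, P x = 0 := by
    have hconst : ∀ x, P x = C := by
      intro x
      rw [hPC]
      simp only
      rw [intervalIntegral.integral_congr_ae (g := fun _ => (0 : ℝ))
        (hkκ.mono fun x hx _ => by rw [hx, hκ0, zero_mul])]
      simp
    have := hP.integral_eq_zero
    simp only [hconst] at this ⊢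
    simpa using this
  refine ⟨c₁, ?_⟩
  filter_upwards [h₁.1, hPw, hkκ] with x a1 a2 a3
  rw [a2, a3, hκ0, hP0] at a1
  simp at a1
  linarith

/-- The solution family extends smoothly to `μ = 0`, so `lam → ∞` becomes continuity at a regular
point. -/
theorem tendsto_corrector {ρ : ℝ → ℝ} {m M : ℝ} (hρ : IsBoundedRate ρ m M) :
    Tendsto (corrector hρ) atTop (𝓝 0) := by
  have h1 : Tendsto (fun μ => heightOperator hρ (curvatureCoeffs hρ μ)) (𝓝 0)
      (𝓝 (heightOperator hρ (curvatureCoeffs hρ 0))) :=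
    ((heightOperator hρ).continuous.comp (contDiff_curvatureCoeffs hρ).continuous).tendsto 0
  have h0 : curvatureCoeffs hρ 0 = 0 := zero_smul _ _
  rw [h0, map_zero] at h1
  exact h1.comp tendsto_inv_atTop_zero

theorem contDiffOn_corrector {ρ : ℝ → ℝ} {m M : ℝ} (hρ : IsBoundedRate ρ m M) :
    ContDiffOn ℝ ∞ (corrector hρ) (Ioi 0) :=
  ((heightOperator hρ).contDiff.comp (contDiff_curvatureCoeffs hρ)).comp_contDiffOn
    (contDiffOn_id.inv fun _ hx => ne_of_gt hx)

/-! ### Reduction to the homogenized rate and conclusion -/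

theorem IsMaterialParameter.periodMean_pos {f : ℝ → ℝ} (hf : IsMaterialParameter f) :
    0 < periodMean f := by
  obtain ⟨fm, fM, hfm, hb⟩ := hf.bounds
  have hρ : IsBoundedRate f fm fM := ⟨hf.aemeasurable, hf.periodic, hfm, hb⟩
  exact hfm.trans_le hρ.le_primitive_one

theorem exists_isBoundedRate_cellRate {R : ℝ → ℝ → ℝ} {g b : ℝ → ℝ} (hR : IsCombustionRate R)
    (hg : IsMaterialParameter g) (hb : IsMaterialParameter b) :
    ∃ m M, IsBoundedRate (cellRate R g b) m M := by
  have hT : 0 < periodMean g / periodMean b := div_pos hg.periodMean_pos hb.periodMean_pos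
  obtain ⟨m, hm, hm'⟩ := hR.essinf_pos _ hT
  obtain ⟨M, hM⟩ := hR.bounds
  refine ⟨m, M, hR.aemeasurable _ hT, hR.periodic _ hT, hm, ?_⟩
  filter_upwards [hm', hM] with z h1 h2
  exact ⟨h1, (h2 _ hT).2⟩

theorem mainTheorem8 (R : ℝ → ℝ → ℝ) (g b : ℝ → ℝ)
    (hR : IsCombustionRate R) (hg : IsMaterialParameter g) (hb : IsMaterialParameter b) :
    ∃ (c : ℝ → ℝ) (w : ℝ → W2InfPer),
      (∀ lam : ℝ, 0 < lam → ∀ (c' : ℝ) (w' : W2InfPer),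
        IsCorrector (cellRate R g b) lam c' w' ↔ c' = c lam ∧ w' = w lam) ∧
      ContDiffOn ℝ ∞ w (Ioi 0) ∧
      ((¬ ∃ k : ℝ, ∀ᵐ z : ℝ, cellRate R g b z = k) → InjOn w (Ioi 0)) ∧
      Tendsto w atTop (𝓝 0) := by
  obtain ⟨m, M, hρ⟩ := exists_isBoundedRate_cellRate hR hg hb
  refine ⟨fun lam => (cellSolution hρ lam⁻¹).2.1, corrector hρ, fun lam hlam c' w' => ⟨fun h =>
    h.unique hρ hlam (isCorrector_corrector hρ hlam), ?_⟩, contDiffOn_corrector hρ,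
    corrector_injOn hρ, tendsto_corrector hρ⟩
  rintro ⟨rfl, rfl⟩
  exact isCorrector_corrector hρ hlam
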